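/- Let $H$ be a complex Hilbert space, let $\mathcal N\subset B(H)$ be a von Neumann algebra with a faithful normal semifinite trace $\tau$, and write $\tau$ also for its linear extension to $\mathcal L_1(\mathcal N,\tau)$. For $A\in\mathcal N$ and $t\ge 0$ put $\mu(t,A)=\inf\{\|Ap\| : p\in\mathcal N \text{ a projection},\ \tau(1-p)\le t\}$, and let $$\mathcal M_{1,\infty}=\Big\{A\in\mathcal N:\ \sup_{t>0}\frac1{\log(1+t)}\int_0^t\mu(s,A)\,ds<\infty\Big\}.$$ Let $L_\infty(0,\infty)$ be the space of bounded Lebesgue measurable real functions on $(0,\infty)$. A generalised limit is a positive linear functional $\gamma:L_\infty(0,\infty)\to\mathbb R$ with $\gamma(1)=1$ and $\gamma(z)=0$ whenever $\lim_{t\to\infty}z(t)=0$. If $x$ is a real function on $(0,\infty)$ that is measurable and bounded on $[1,\infty)$, but possibly not near $0$, we write $\gamma(x)$ for $\gamma(x\chi_{[1,\infty)})$; this agrees with the original value if $x\in L_\infty(0,\infty)$, and the cut-off point $1$ may be replaced by any larger one. We extend $\gamma$ to complex functions by complex linearity. For $B\in\mathcal N$ and a positive operator $A\in\mathcal M_{1,\infty}$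 set $$\zeta_\gamma(A)=\gamma\Big(\frac1t\tau(A^{1+1/t})\Big),\qquad \zeta_{\gamma,B}(A)=\gamma\Big(\frac1t\tau(A^{1+1/t}B)\Big),$$ and for an arbitrary $A\in\mathcal M_{1,\infty}$ set $$\zeta_\gamma(A)=\zeta_\gamma((\Re A)_+)-\zeta_\gamma((\Re A)_-)+i\big(\zeta_\gamma((\Im A)_+)-\zeta_\gamma((\Im A)_-)\big),$$ where $X_+$ and $X_-$ are the positive operators with $X=X_+-X_-$ and $X_+X_-=0$ for a self-adjoint $X$, and define $\zeta_{\gamma,B}(A)$ in the same way. Then for every generalised limit $\gamma$, every $A\in\mathcal M_{1,\infty}$ and every $B\in\mathcal N$, one has $AB\in\mathcal M_{1,\infty}$, both $\zeta_{\gamma,B}(A)$ and $\zeta_\gamma(AB)$ are well defined (all the traces involved are finite, and the functions to which $\gamma$ is applied are measurable and bounded on $[1,\infty)$), and $$\zeta_{\gamma,B}(A)=\zeta_\gamma(AB).$$ -/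

import Mathlib

open scoped ENNReal ComplexStarModule

/-! ### Bounded measurable functions on the half-line and generalised limits -/

/-- The space of all bounded Lebesgue measurable real functions on `(0, ∞)`.
Functions are not identified almost everywhere; a functional on almost everywhere classes is
the same as a functional on this space that vanishes on the null functions, so statements about
all functionals on this space cover both conventions. -/
def LInfty : Submodule ℝ (Set.Ioi (0 : ℝ) → ℝ) where
  carrier := {x | AEMeasurable x (MeasureTheory.volume.comap Subtype.val) ∧ ∃ C : ℝ, ∀ t, |x t| ≤ C}
  add_mem' := by
    rintro x y ⟨hx, C, hC⟩ ⟨hy, D, hD⟩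
    exact ⟨hx.add hy, C + D, fun t => (abs_add_le _ _).trans (add_le_add (hC t) (hD t))⟩
  zero_mem' := ⟨aemeasurable_const, 0, fun t => by simp⟩
  smul_mem' := by
    rintro c x ⟨hx, C, hC⟩
    refine ⟨hx.const_smul c, |c| * C, fun t => ?_⟩
    simpa [abs_mul] using mul_le_mul_of_nonneg_left (hC t) (abs_nonneg c)

/-- The constant function `1` is bounded and measurable. -/
theorem one_mem_LInfty : (1 : Set.Ioi (0 : ℝ) → ℝ) ∈ LInfty :=
  ⟨aemeasurable_const, 1, fun t => by simp⟩

/-- A generalised limit: a positive normalised linear functional on `L_∞(0, ∞)` that vanishes on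
every function with limit `0` at infinity. -/
structure GeneralisedLimit where
  toLinearMap : LInfty →ₗ[ℝ] ℝ
  nonneg' : ∀ x : LInfty, (∀ t, 0 ≤ x.1 t) → 0 ≤ toLinearMap x
  map_one' : toLinearMap ⟨1, one_mem_LInfty⟩ = 1
  vanish' : ∀ x : LInfty,
    (∀ ε : ℝ, 0 < ε → ∃ T : ℝ, ∀ t : Set.Ioi (0 : ℝ), T ≤ t → |x.1 t| ≤ ε) → toLinearMap x = 0

/-- The function `x · χ_{[1, ∞)}`. -/
noncomputable def tailPart (x : Set.Ioi (0 : ℝ) → ℝ) : Set.Ioi (0 : ℝ) → ℝ :=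
  Set.indicator {t | (1 : ℝ) ≤ t} x

open Classical in
/-- The value `γ(x)` of a generalised limit at a function `x` on `(0, ∞)` that is bounded and
measurable on `[1, ∞)` but possibly unbounded near `0`, as `t ↦ t⁻¹ τ(A ^ (1 + 1/t))` is in
general. For `x ∈ L_∞(0, ∞)` it is the original value, and the cut-off point `1` is immaterial,
because `γ` vanishes on the bounded functions that are `0` near infinity. (The default `0` is only
used for functions that are not bounded and measurable on `[1, ∞)`.) -/
noncomputable def GeneralisedLimit.eval (γ : GeneralisedLimit) (x : Set.Ioi (0 : ℝ) → ℝ) : ℝ :=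
  if h : tailPart x ∈ LInfty then γ.toLinearMap ⟨tailPart x, h⟩ else 0

/-- The complex-linear extension of a generalised limit to complex-valued functions. -/
noncomputable def GeneralisedLimit.evalC (γ : GeneralisedLimit)
    (x : Set.Ioi (0 : ℝ) → ℂ) : ℂ :=
  (γ.eval fun t => (x t).re) + Complex.I * (γ.eval fun t => (x t).im)

section Operators

variable {H : Type*} [NormedAddCommGroup H] [InnerProductSpace ℂ H] [CompleteSpace H]

/-! ### The Jordan decomposition -/

/-- The extension to all bounded operators, through
`A = ((Re A)₊ - (Re A)₋) + i ((Im A)₊ - (Im A)₋)`, of a function `F` given on positive operators.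
All four parts are positive operators. -/
noncomputable def jordanExtend (F : (H →L[ℂ] H) → ℂ) (A : H →L[ℂ] H) : ℂ :=
  (F ((ℜ A : H →L[ℂ] H)⁺) - F ((ℜ A : H →L[ℂ] H)⁻)) +
    Complex.I * (F ((ℑ A : H →L[ℂ] H)⁺) - F ((ℑ A : H →L[ℂ] H)⁻))

/-- All four positive parts of `A` have the property `p`. -/
def JordanForall (p : (H →L[ℂ] H) → Prop) (A : H →L[ℂ] H) : Prop :=
  p ((ℜ A : H →L[ℂ] H)⁺) ∧ p ((ℜ A : H →L[ℂ] H)⁻) ∧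
    p ((ℑ A : H →L[ℂ] H)⁺) ∧ p ((ℑ A : H →L[ℂ] H)⁻)

/-! ### Traces on a von Neumann algebra -/

/-- A faithful normal semifinite trace on the von Neumann algebra `N`. It is a `[0, ∞]`-valued
function on the positive cone of `N`; its values elsewhere carry no information and are never
used. The order is the usual order of operators. -/
structure FNSTrace (N : VonNeumannAlgebra H) where
  toFun : (H →L[ℂ] H) → ℝ≥0∞
  map_add' : ∀ A ∈ N, ∀ B ∈ N, 0 ≤ A → 0 ≤ B → toFun (A + B) = toFun A + toFun B
  map_smul' : ∀ c : ℝ, 0 ≤ c → ∀ A ∈ N, 0 ≤ A → toFun (c • A) = ENNReal.ofReal c * toFun A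
  tracial' : ∀ X ∈ N, toFun (star X * X) = toFun (X * star X)
  faithful' : ∀ A ∈ N, 0 ≤ A → toFun A = 0 → A = 0
  normal' : ∀ S : Set (H →L[ℂ] H), (∀ A ∈ S, A ∈ N ∧ 0 ≤ A) → S.Nonempty →
    DirectedOn (· ≤ ·) S → ∀ A ∈ N, IsLUB S A → toFun A = ⨆ X ∈ S, toFun X
  semifinite' : ∀ A ∈ N, 0 ≤ A → A ≠ 0 → ∃ X ∈ N, 0 ≤ X ∧ X ≤ A ∧ X ≠ 0 ∧ toFun X < ∞

namespace FNSTrace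

variable {N : VonNeumannAlgebra H} (τ : FNSTrace N)

/-- `X` is in the domain `L₁(N, τ)` of the extended trace. -/
def Finite (X : H →L[ℂ] H) : Prop :=
  JordanForall (fun P => τ.toFun P < ∞) X

/-- The linear extension of the trace to `L₁(N, τ)`. -/
noncomputable def ext (X : H →L[ℂ] H) : ℂ :=
  jordanExtend (fun P => ((τ.toFun P).toReal : ℂ)) X

/-- The generalised singular value function
`μ(t, A) = inf {‖A p‖ : p a projection in N, τ(1 - p) ≤ t}`. -/
noncomputable def mu (t : ℝ) (A : H →L[ℂ] H) : ℝ :=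
  sInf {r : ℝ | ∃ p ∈ N, IsStarProjection p ∧ τ.toFun (1 - p) ≤ ENNReal.ofReal t ∧ r = ‖A * p‖}

/-- The Marcinkiewicz operator space `M_{1,∞}(N, τ)`: all `A ∈ N` with
`sup_{t > 0} (log (1 + t))⁻¹ ∫₀ᵗ μ(s, A) ds < ∞`. -/
def M1Infty : Set (H →L[ℂ] H) :=
  {A | A ∈ N ∧ ∃ C : ℝ, ∀ t : ℝ, 0 < t →
    1 / Real.log (1 + t) * (∫ s in (0 : ℝ)..t, τ.mu s A) ≤ C}

/-! ### Zeta functions and zeta functionals -/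

/-- The function `t ↦ t⁻¹ τ(P ^ (1 + 1/t))` for positive `P`. -/
noncomputable def zetaFun (P : H →L[ℂ] H) (t : Set.Ioi (0 : ℝ)) : ℝ :=
  1 / (t : ℝ) * (τ.toFun (P ^ (1 + 1 / (t : ℝ)))).toReal

/-- The function `t ↦ t⁻¹ τ(P ^ (1 + 1/t) B)` for positive `P`. -/
noncomputable def zetaFunTwisted (B P : H →L[ℂ] H) (t : Set.Ioi (0 : ℝ)) : ℂ :=
  1 / ((t : ℝ) : ℂ) * τ.ext (P ^ (1 + 1 / (t : ℝ)) * B)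

/-- The functional `ζ_γ`, given by `γ(t⁻¹ τ(A ^ (1 + 1/t)))` on positive operators and extended
through the Jordan decomposition. -/
noncomputable def zeta (γ : GeneralisedLimit) (A : H →L[ℂ] H) : ℂ :=
  jordanExtend (fun P => (γ.eval (τ.zetaFun P) : ℂ)) A

/-- The functional `ζ_{γ,B}`, given by `γ(t⁻¹ τ(A ^ (1 + 1/t) B))` on positive operators and
extended through the Jordan decomposition. -/
noncomputable def zetaTwisted (γ : GeneralisedLimit) (B A : H →L[ℂ] H) : ℂ :=
  jordanExtend (fun P => γ.evalC (τ.zetaFunTwisted B P)) A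

/-- `ζ_γ(A)` is well defined for every generalised limit `γ`: the traces involved are finite, and
the zeta functions are bounded and measurable on `[1, ∞)`. -/
def ZetaDefined (A : H →L[ℂ] H) : Prop :=
  JordanForall (fun P =>
    (∀ t : Set.Ioi (0 : ℝ), τ.toFun (P ^ (1 + 1 / (t : ℝ))) < ∞) ∧
      tailPart (τ.zetaFun P) ∈ LInfty) A

/-- `ζ_{γ,B}(A)` is well defined for every generalised limit `γ`. -/
def ZetaTwistedDefined (B A : H →L[ℂ] H) : Prop :=
  JordanForall (fun P =>
    (∀ t : Set.Ioi (0 : ℝ), τ.Finite (P ^ (1 + 1 / (t : ℝ)) * B)) ∧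
      tailPart (fun t => (τ.zetaFunTwisted B P t).re) ∈ LInfty ∧
      tailPart (fun t => (τ.zetaFunTwisted B P t).im) ∈ LInfty) A

end FNSTrace

end Operators

/-! ### Bicommutant property: a von Neumann algebra is closed under functional calculus. -/

section VonNeumann

variable {H : Type*} [NormedAddCommGroup H] [InnerProductSpace ℂ H] [CompleteSpace H]

namespace VonNeumannAlgebra

variable {N : VonNeumannAlgebra H} {a : H →L[ℂ] H}

/-! The core is one identity for positive `P` and `b`, with `s = 1/t` and `Q = P^(1+s)`: the
functions `s τ(Q^{1/2} b Q^{1/2})` and `s τ((P^{1/2} b P^{1/2})^(1+s))` have the same generalised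
limit (`eval_zetaFunConj`). One inequality is direct. If `b ≤ n` then `X = P^{1/2} b P^{1/2} ≤ nP`,
so Löwner–Heinz and traciality give `τ(X^(1+s)) ≤ n^s τ(P^{s/2} X P^{s/2}) = n^s τ(Q^{1/2} b
Q^{1/2})`, and `n^s → 1`. The same inequality holds for `n - b`. Both sides are additive in `b` and
agree at `b = n`, so both inequalities are equalities.

Additivity on the side of the zeta functional comes from the bounds `τ(P^(1+s)) + τ(Q^(1+s)) ≤
τ((P+Q)^(1+s)) ≤ 2^s (τ(P^(1+s)) + τ(Q^(1+s)))` for positive `P`, `Q`, the first by Löwner–Heinz and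
the second by operator convexity of the power.

The positive operators are handled in `logCone`, where `τ((P - 2⁻ᵏ)₊)` is at most linear in `k`.
Unlike a condition on singular values, this is easily seen to be stable under sums, under `X*X ↦
XX*`, and under passing to `X⁺` when `X ≤ P`. It forces `τ(P^(1+s)) = O(1/s)`, so the zeta functions
are bounded. It contains `|A|` and `|A*|` for `A` in the Marcinkiewicz space, hence all four Jordan
parts of `A`, since `A + A* ≤ |A| + |A*|`.

The passage from positive operators to arbitrary ones is formal. For every `TracialFunctional`, the
Jordan extension is complex linear, and polarisation gives `φ(Pb) = φ(P^{1/2} b P^{1/2})`. This is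
used twice: for the trace, to expand `τ(P^(1+s) B)`, and for the zeta functional, to expand
`ζ_γ(PB)`. The core identity matches the two expansions term by term, and linearity in `A` finishes
the proof. -/

theorem mem_of_forall_commute {b : H →L[ℂ] H} (ha : a ∈ N)
    (h : ∀ g, Commute a g → Commute b g) : b ∈ N := by
  rw [← commutant_commutant N, mem_commutant_iff]
  intro g hg
  exact (h g (mem_commutant_iff.1 hg a ha)).eq.symm

theorem cfc_mem (ha : a ∈ N) (f : ℝ → ℝ) : cfc f a ∈ N :=
  mem_of_forall_commute ha fun _ h => h.cfc_real f

theorem rpow_mem (ha : a ∈ N) (s : ℝ) : a ^ s ∈ N :=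
  mem_of_forall_commute ha fun _ h => h.cfc_nnreal _

theorem sqrt_mem (ha : a ∈ N) : CFC.sqrt a ∈ N :=
  mem_of_forall_commute ha fun _ h => h.cfcₙ_nnreal _

theorem posPart_mem (ha : a ∈ N) : a⁺ ∈ N :=
  mem_of_forall_commute ha fun _ h => h.cfcₙ_real _

theorem negPart_mem (ha : a ∈ N) : a⁻ ∈ N :=
  mem_of_forall_commute ha fun _ h => h.cfcₙ_real _

theorem complex_smul_mem (c : ℂ) (ha : a ∈ N) : c • a ∈ N :=
  N.toStarSubalgebra.smul_mem ha c

theorem real_smul_mem (c : ℝ) (ha : a ∈ N) : c • a ∈ N := by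
  rw [← Complex.coe_smul]
  exact complex_smul_mem _ ha

theorem algebraMap_real_mem (c : ℝ) : algebraMap ℝ (H →L[ℂ] H) c ∈ N := by
  rw [Algebra.algebraMap_eq_smul_one]
  exact real_smul_mem _ (one_mem N)

theorem realPart_mem (ha : a ∈ N) : (ℜ a : H →L[ℂ] H) ∈ N := by
  rw [realPart_apply_coe]
  exact real_smul_mem _ (add_mem ha (star_mem ha))

theorem imaginaryPart_mem (ha : a ∈ N) : (ℑ a : H →L[ℂ] H) ∈ N := by
  rw [imaginaryPart_apply_coe]
  exact complex_smul_mem _ (real_smul_mem _ (sub_mem ha (star_mem ha)))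

end VonNeumannAlgebra

end VonNeumann

/-! ### Intertwining the functional calculi of `x*x` and `xx*`. -/

section CStar

variable {A : Type*} [CStarAlgebra A]

/-- Clear for the identity function, hence for polynomials, hence for continuous functions by
density. Both calculi are viewed on `C(s)`, with `s` the union of the two spectra, so that one
induction serves both. -/
theorem mul_cfc_star_mul_self (x : A) (f : ℝ → ℝ) (hf : Continuous f) :
    x * cfc f (star x * x) = cfc f (x * star x) * x := by
  set a := star x * x with ha
  set b := x * star x with hb
  have sa : IsSelfAdjoint a := .star_mul_self x
  have sb : IsSelfAdjoint b := .mul_star_self x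
  set s : Set ℝ := spectrum ℝ a ∪ spectrum ℝ b
  have hsa : spectrum ℝ a ⊆ s := Set.subset_union_left
  have hsb : spectrum ℝ b ⊆ s := Set.subset_union_right
  have : CompactSpace s := isCompact_iff_compactSpace.1
    ((ContinuousFunctionalCalculus.isCompact_spectrum a).union
      (ContinuousFunctionalCalculus.isCompact_spectrum b))
  have key (g : C(s, ℝ)) :
      x * cfcHomSuperset sa hsa g = cfcHomSuperset sb hsb g * x := by
    induction g using ContinuousMap.induction_on_of_compact with
    | const r =>
      have h (r : ℝ) : ContinuousMap.const s r = algebraMap ℝ C(s, ℝ) r := rfl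
      rw [h, AlgHomClass.commutes, AlgHomClass.commutes]
      exact (Algebra.commutes r x).symm
    | id =>
      rw [cfcHomSuperset_id, cfcHomSuperset_id, ha, hb, mul_assoc]
    | star_id =>
      rw [map_star, map_star, cfcHomSuperset_id, cfcHomSuperset_id, sa.star_eq, sb.star_eq,
        ha, hb, mul_assoc]
    | add f g hf hg => rw [map_add, map_add, mul_add, add_mul, hf, hg]
    | mul f g hf hg => rw [map_mul, map_mul, ← mul_assoc, hf, mul_assoc, hg, mul_assoc]
    | frequently f hf =>
      have hc : IsClosed {g : C(s, ℝ) |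
          x * cfcHomSuperset sa hsa g = cfcHomSuperset sb hsb g * x} :=
        isClosed_eq (continuous_const.mul (cfcHomSuperset_continuous sa hsa))
          ((cfcHomSuperset_continuous sb hsb).mul continuous_const)
      exact hc.closure_subset (mem_closure_of_frequently_of_tendsto hf Filter.tendsto_id)
  have h := key ⟨s.domRestrict f, hf.continuousOn.domRestrict⟩
  rw [cfc_apply f a, cfc_apply f b]
  exact h

theorem mul_cfc_star_mul_self_mul_star (x : A) (g : ℝ → ℝ) (hg : Continuous g) :
    x * cfc g (star x * x) * star x = cfc (fun r => r * g r) (x * star x) := by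
  have sb : IsSelfAdjoint (x * star x) := .mul_star_self x
  rw [mul_cfc_star_mul_self x g hg, mul_assoc,
    cfc_mul (fun r : ℝ => r) g (x * star x) continuousOn_id hg.continuousOn,
    (cfc_commute_cfc (fun r : ℝ => r) g (x * star x)).eq, cfc_id' ..]

end CStar

/-! ### Operator convexity of powers, and an order bound by absolute values. -/

section CStarOrder
variable {A : Type*} [CStarAlgebra A] [PartialOrder A] [StarOrderedRing A]

theorem CFC.rpow_mul_rpow {a : A} {x y : ℝ} (hx : 0 < x) (hy : 0 < y) :
    a ^ x * a ^ y = a ^ (x + y) := by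
  lift x to NNReal using hx.le
  lift y to NNReal using hy.le
  have hx' : 0 < x := by exact_mod_cast hx
  have hy' : 0 < y := by exact_mod_cast hy
  rw [← NNReal.coe_add, ← CFC.nnrpow_eq_rpow hx', ← CFC.nnrpow_eq_rpow hy',
    ← CFC.nnrpow_eq_rpow (add_pos hx' hy'), CFC.nnrpow_add hx' hy']

theorem CFC.sqrt_rpow' {a : A} {x : ℝ} (hx : 0 ≤ x) :
    CFC.sqrt (a ^ x) = a ^ (x / 2) := by
  lift x to NNReal using hx
  exact CFC.sqrt_rpow_nnreal

/-- The integrand is affine in `x` plus a positive multiple of `(t + x)⁻¹`, and inversion is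
operator convex. -/
theorem convexOn_rpowIntegrand (p t : ℝ) (hp : p ∈ Set.Ioo 1 2) (ht : 0 < t) :
    ConvexOn ℝ (Set.Ici (0 : A)) (cfc (Real.rpowIntegrand₁₂ p t)) := by
  have h₁ : (Set.Ici (0 : A)).EqOn (cfc (Real.rpowIntegrand₁₂ p t))
      (fun x : A => (t ^ (p - 1) * t⁻¹) • x +
        ((t ^ (p - 1) * t) • Ring.inverse (algebraMap ℝ A t + x) -
          algebraMap ℝ A (t ^ (p - 1)))) := by
    intro x hx
    have hx0 : 0 ≤ x := hx
    have hspectrum : ∀ r ∈ spectrum ℝ x, t + r ≠ 0 := by grind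
    have hg : ContinuousOn (fun z : ℝ => (t + z)⁻¹) (spectrum ℝ x) := by
      fun_prop (disch := grind -abstractProof)
    have e : Real.rpowIntegrand₁₂ p t = fun z => (t ^ (p - 1) * t⁻¹) * z +
        ((t ^ (p - 1) * t) * (t + z)⁻¹ - t ^ (p - 1)) := by
      ext z; simp only [Real.rpowIntegrand₁₂]; ring
    rw [e]
    generalize t ^ (p - 1) * t⁻¹ = c
    generalize t ^ (p - 1) * t = d
    generalize t ^ (p - 1) = e
    have hg' : ContinuousOn (fun z : ℝ => d * (t + z)⁻¹) (spectrum ℝ x) := hg.const_smul d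
    have h1 : cfc (fun z : ℝ => (t + z)⁻¹) x = Ring.inverse (algebraMap ℝ A t + x) := by
      rw [cfc_inv _ _ hspectrum .., cfc_const_add .., cfc_id' ..]
    rw [cfc_add (a := x) (fun z : ℝ => c * z) (fun z : ℝ => d * (t + z)⁻¹ - e)
        (by fun_prop) (hg'.sub continuousOn_const),
      cfc_sub (fun z : ℝ => d * (t + z)⁻¹) (fun _ => e) x hg' continuousOn_const,
      cfc_const e x, cfc_const_mul d _ x hg, h1, cfc_const_mul_id c x]
  refine ConvexOn.congr ?_ h₁.symm
  refine ConvexOn.add ((convexOn_id (convex_Ici 0)).smul (by positivity)) ?_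
  refine ConvexOn.sub ?_ (concaveOn_const _ (convex_Ici 0))
  exact ConvexOn.smul (by positivity) <| CStarAlgebra.convexOn_ringInverse_algebraMap_add ht

/-- The power is an integral of the operator convex functions above. The representation requires `1
< p < 2`; the excluded endpoint is why later estimates ask for `s < 1`, that is `t > 1`. -/
theorem CFC.convexOn_rpow {p : ℝ} (hp : p ∈ Set.Ioo 1 2) :
    ConvexOn ℝ (Set.Ici (0 : A)) (fun a : A => a ^ p) := by
  lift p to NNReal using by linarith [hp.1]
  have hp' : p ∈ Set.Ioo 1 2 := by exact_mod_cast hp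
  obtain ⟨μ, hμ⟩ := CFC.exists_measure_nnrpow_eq_integral_cfcₙ_rpowIntegrand₁₂ A hp'
  have h : (Set.Ici 0).EqOn (fun a : A => a ^ (p : ℝ))
      (fun a : A => ∫ t in Set.Ioi 0, cfcₙ (Real.rpowIntegrand₁₂ p t) a ∂μ) := by
    intro a ha
    have := (hμ a ha).2
    rwa [CFC.nnrpow_eq_rpow (zero_lt_one.trans hp'.1)] at this
  refine ConvexOn.congr ?_ h.symm
  refine MeasureTheory.integral_convexOn_of_integrand_ae (convex_Ici _) ?_ fun a ha => (hμ a ha).1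
  filter_upwards [MeasureTheory.ae_restrict_mem measurableSet_Ioi] with t ht
  refine (convexOn_rpowIntegrand p t hp ht).congr fun a ha => ?_
  have ha0 : 0 ≤ a := ha
  have hc : ContinuousOn (Real.rpowIntegrand₁₂ p t) (quasispectrum ℝ a) := by
    have hne : ∀ z ∈ quasispectrum ℝ a, t + z ≠ 0 := fun z hz =>
      (add_pos_of_pos_of_nonneg ht (quasispectrum_nonneg_of_nonneg a ha0 z hz)).ne'
    unfold Real.rpowIntegrand₁₂
    fun_prop (disch := assumption)
  rw [cfcₙ_eq_cfc hc (Real.rpowIntegrand₁₂_zero ht)]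

theorem CFC.abs_eq_cfc_sqrt (x : A) : CFC.abs x = cfc Real.sqrt (star x * x) := by
  rw [CFC.abs, CFC.sqrt_eq_real_sqrt _ (star_mul_self_nonneg x), cfcₙ_eq_cfc]

/-- The sum of an element and its adjoint is dominated by the sum of the two absolute values. -/
theorem add_star_le_abs_add_abs_star (x : A) : x + star x ≤ CFC.abs x + CFC.abs (star x) := by
  have key (ε : ℝ) (hε : 0 < ε) :
      x + star x ≤ CFC.abs x + CFC.abs (star x) + algebraMap ℝ A ε := by
    set a := star x * x with ha
    have sa : IsSelfAdjoint a := .star_mul_self x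
    have a0 : 0 ≤ a := star_mul_self_nonneg x
    have b0 : 0 ≤ x * star x := mul_star_self_nonneg x
    have sb : IsSelfAdjoint (x * star x) := .mul_star_self x
    -- `T = (|x| + ε)^{1/2}` and `S = T⁻¹`. Truncating at `0` makes the defining functions
    -- continuous on the whole line; it changes nothing on the spectra.
    have hpos (r : ℝ) : 0 < Real.sqrt (r ⊔ 0) + ε := by positivity
    have hposq (r : ℝ) : 0 < Real.sqrt (Real.sqrt (r ⊔ 0) + ε) := Real.sqrt_pos.2 (hpos r)
    set g : ℝ → ℝ := fun r => Real.sqrt (Real.sqrt (r ⊔ 0) + ε) with hg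
    have cg : Continuous g := by fun_prop
    have cgi : Continuous fun r => (g r)⁻¹ := cg.inv₀ fun r => (hposq r).ne'
    set T := cfc g a with hT
    set S := cfc (fun r => (g r)⁻¹) a with hS
    have sT : star T = T := (cfc_predicate g a : IsSelfAdjoint _)
    have sS : star S = S := (cfc_predicate _ a : IsSelfAdjoint _)
    have hTS : T * S = 1 := by
      rw [hT, hS, ← cfc_mul g _ a cg.continuousOn cgi.continuousOn, ← cfc_one ℝ a]
      exact cfc_congr fun r _ => mul_inv_cancel₀ (hposq r).ne'
    have hST : S * T = 1 := by
      rw [← hTS]; exact (cfc_commute_cfc _ g a).eq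
    -- Completing the square: the cross terms are `x + x*`, and `x S² x*` is the function `r / (√r +
    -- ε) ≤ √r` of `xx*`.
    have h0 : 0 ≤ star (T - S * star x) * (T - S * star x) := star_mul_self_nonneg _
    have e1 : star (T - S * star x) * (T - S * star x) =
        T * T - (x + star x) + x * (S * S) * star x := by
      rw [star_sub, star_mul, star_star, sT, sS]
      calc (T - x * S) * (T - S * star x)
          = T * T - (T * S) * star x - x * (S * T) + x * (S * S) * star x := by noncomm_ring
        _ = _ := by rw [hTS, hST]; noncomm_ring
    have e2 : T * T = CFC.abs x + algebraMap ℝ A ε := by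
      rw [CFC.abs_eq_cfc_sqrt, ← ha, hT, ← cfc_mul g g a cg.continuousOn cg.continuousOn,
        ← cfc_add_const ε _ a]
      refine cfc_congr fun r hr => ?_
      simp only [hg]
      rw [Real.mul_self_sqrt (hpos r).le, sup_of_le_left (spectrum_nonneg_of_nonneg a0 hr)]
    have e3 : x * (S * S) * star x ≤ CFC.abs (star x) := by
      rw [CFC.abs_eq_cfc_sqrt, star_star, hS,
        ← cfc_mul _ _ a cgi.continuousOn cgi.continuousOn,
        mul_cfc_star_mul_self_mul_star x (fun r => (g r)⁻¹ * (g r)⁻¹) (cgi.mul cgi)]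
      refine cfc_mono (fun r hr => ?_) (by fun_prop) (by fun_prop)
      have hr0 : 0 ≤ r := spectrum_nonneg_of_nonneg b0 hr
      simp only [hg]
      rw [← mul_inv, Real.mul_self_sqrt (hpos r).le, sup_of_le_left hr0,
        mul_inv_le_iff₀ (by positivity)]
      nlinarith [Real.mul_self_sqrt hr0, Real.sqrt_nonneg r]
    rw [e1, e2] at h0
    have h1 : 0 ≤ CFC.abs x + algebraMap ℝ A ε - (x + star x) + CFC.abs (star x) :=
      h0.trans (by gcongr)
    rw [← sub_nonneg]
    convert h1 using 1
    abel
  have hlim : Filter.Tendsto (fun ε : ℝ => CFC.abs x + CFC.abs (star x) + algebraMap ℝ A ε)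
      (nhdsWithin 0 (Set.Ioi 0)) (nhds (CFC.abs x + CFC.abs (star x) + algebraMap ℝ A 0)) :=
    ((continuous_const.add (algebraMapCLM ℝ A).continuous).tendsto 0).mono_left
      nhdsWithin_le_nhds
  rw [map_zero, add_zero] at hlim
  exact ge_of_tendsto hlim (Filter.mem_of_superset self_mem_nhdsWithin fun ε hε => key ε hε)

end CStarOrder

/-! ### Trace inequalities and comparison of projections. -/

section Trace

variable {H : Type*} [NormedAddCommGroup H] [InnerProductSpace ℂ H] [CompleteSpace H]

namespace FNSTrace

variable {N : VonNeumannAlgebra H} (τ : FNSTrace N)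

open VonNeumannAlgebra

theorem map_zero : τ.toFun 0 = 0 := by
  simpa using τ.map_smul' 0 le_rfl 0 (zero_mem N) le_rfl

theorem mono {A B : H →L[ℂ] H} (hA : A ∈ N) (hB : B ∈ N) (h0 : 0 ≤ A) (h : A ≤ B) :
    τ.toFun A ≤ τ.toFun B := by
  have := τ.map_add' A hA (B - A) (sub_mem hB hA) h0 (sub_nonneg.2 h)
  rw [add_sub_cancel] at this
  rw [this]
  exact le_self_add

theorem le_of_tendsto_of_monotone {X : ℕ → H →L[ℂ] H} {Y : H →L[ℂ] H} {c : ℝ≥0∞}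
    (hX : ∀ n, X n ∈ N) (h0 : ∀ n, 0 ≤ X n) (hm : Monotone X)
    (hl : Filter.Tendsto X Filter.atTop (nhds Y)) (hY : Y ∈ N) (hc : ∀ n, τ.toFun (X n) ≤ c) :
    τ.toFun Y ≤ c := by
  have hlub : IsLUB (Set.range X) Y := isLUB_of_tendsto_atTop hm hl
  rw [τ.normal' (Set.range X) (by rintro _ ⟨n, rfl⟩; exact ⟨hX n, h0 n⟩) (Set.range_nonempty X)
    hm.directed_le.directedOn_range Y hY hlub]
  simp only [Set.mem_range, iSup_exists, iSup_le_iff]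
  rintro _ n rfl
  exact hc n

/-- Normality along a sequence of functions of one operator that increases uniformly. -/
theorem cfc_le_of_tendsto {a : H →L[ℂ] H} (ha : a ∈ N) {c : ℝ≥0∞} {h : ℕ → ℝ → ℝ} {f : ℝ → ℝ}
    (hh : ∀ n, Continuous (h n)) (hf : Continuous f)
    (h0 : ∀ n, ∀ x ∈ spectrum ℝ a, 0 ≤ h n x)
    (hm : ∀ n, ∀ x ∈ spectrum ℝ a, h n x ≤ h (n + 1) x) {ε : ℕ → ℝ}
    (hε : Filter.Tendsto ε Filter.atTop (nhds 0))
    (hle : ∀ n, ∀ x ∈ spectrum ℝ a, |f x - h n x| ≤ ε n)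
    (hc : ∀ n, τ.toFun (cfc (h n) a) ≤ c) : τ.toFun (cfc f a) ≤ c := by
  by_cases hsa : IsSelfAdjoint a
  swap
  · simp [cfc_apply_of_not_predicate a hsa, τ.map_zero]
  refine τ.le_of_tendsto_of_monotone (X := fun n => cfc (h n) a) (fun n => cfc_mem ha _)
    (fun n => cfc_nonneg (h0 n)) ?_ ?_ (cfc_mem ha _) hc
  · exact monotone_nat_of_le_succ fun n =>
      cfc_mono (hm n) (hh n).continuousOn (hh _).continuousOn
  · rw [tendsto_iff_norm_sub_tendsto_zero]
    refine squeeze_zero' (.of_forall fun n => norm_nonneg _) ?_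
      (by simpa using hε.abs : Filter.Tendsto (fun n => |ε n|) Filter.atTop (nhds 0))
    refine .of_forall fun n => ?_
    rw [← cfc_sub (h n) f a (hh n).continuousOn hf.continuousOn]
    refine norm_cfc_le (abs_nonneg _) fun x hx => ?_
    rw [Real.norm_eq_abs, abs_sub_comm]
    exact (hle n x hx).trans (le_abs_self _)

/-- Traciality at `G Y^{1/2}` turns the left side into the trace of `Y^{1/2} G*G Y^{1/2} ≤ Y`. -/
theorem conj_le {G Y : H →L[ℂ] H} (hG : G ∈ N) (hY : Y ∈ N) (hY0 : 0 ≤ Y)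
    (hG1 : star G * G ≤ 1) : τ.toFun (G * Y * star G) ≤ τ.toFun Y := by
  have hs : CFC.sqrt Y ∈ N := sqrt_mem hY
  have ss : star (CFC.sqrt Y) = CFC.sqrt Y := (CFC.sqrt_nonneg Y).isSelfAdjoint
  have h := τ.tracial' (G * CFC.sqrt Y) (mul_mem hG hs)
  have e1 : G * CFC.sqrt Y * star (G * CFC.sqrt Y) = G * Y * star G := by
    rw [star_mul, ss]
    calc _ = G * (CFC.sqrt Y * CFC.sqrt Y) * star G := by noncomm_ring
      _ = _ := by rw [CFC.sqrt_mul_sqrt_self Y hY0]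
  rw [← e1, ← h]
  refine τ.mono (mul_mem (star_mem (mul_mem hG hs)) (mul_mem hG hs)) hY (star_mul_self_nonneg _) ?_
  have := star_left_conjugate_le_conjugate hG1 (CFC.sqrt Y)
  rw [ss, mul_one, CFC.sqrt_mul_sqrt_self Y hY0] at this
  rw [star_mul, ss]
  convert this using 1
  noncomm_ring

/-- A positive form of `τ(ab) = τ(ba)` that needs no finiteness: traciality at `b^{1/2} a^{1/2}`. -/
theorem sqrt_conj_comm {a b : H →L[ℂ] H} (ha : a ∈ N) (hb : b ∈ N) (ha0 : 0 ≤ a) (hb0 : 0 ≤ b) :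
    τ.toFun (CFC.sqrt a * b * CFC.sqrt a) = τ.toFun (CFC.sqrt b * a * CFC.sqrt b) := by
  have sa : star (CFC.sqrt a) = CFC.sqrt a := (CFC.sqrt_nonneg a).isSelfAdjoint
  have sb : star (CFC.sqrt b) = CFC.sqrt b := (CFC.sqrt_nonneg b).isSelfAdjoint
  have h := τ.tracial' (CFC.sqrt b * CFC.sqrt a) (mul_mem (sqrt_mem hb) (sqrt_mem ha))
  rw [star_mul, sa, sb] at h
  convert h using 2
  · conv_lhs => rw [← CFC.sqrt_mul_sqrt_self b hb0]
    noncomm_ring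
  · conv_lhs => rw [← CFC.sqrt_mul_sqrt_self a ha0]
    noncomm_ring

/-- Traciality at `X h(X*X)` with `h = √g`. The factor `r` makes the function vanish at `0`, where
`X*X` and `XX*` may differ. -/
theorem cfc_star_mul_self {X : H →L[ℂ] H} (hX : X ∈ N) {g : ℝ → ℝ} (hg : Continuous g)
    (hg0 : ∀ x, 0 ≤ g x) :
    τ.toFun (cfc (fun r => r * g r) (star X * X)) =
      τ.toFun (cfc (fun r => r * g r) (X * star X)) := by
  have sa : IsSelfAdjoint (star X * X) := .star_mul_self X
  set h : ℝ → ℝ := fun r => Real.sqrt (g r) with hh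
  have ch : Continuous h := by fun_prop
  have sh : star (cfc h (star X * X)) = cfc h (star X * X) :=
    (cfc_predicate h (star X * X) : IsSelfAdjoint _)
  have e : (fun r => h r * h r) = g := by
    ext r; exact Real.mul_self_sqrt (hg0 r)
  have t := τ.tracial' (X * cfc h (star X * X))
    (mul_mem hX (cfc_mem (mul_mem (star_mem hX) hX) h))
  rw [star_mul, sh] at t
  convert t using 2
  · rw [← e]
    calc cfc (fun r => r * (h r * h r)) (star X * X)
        = cfc (fun r => h r * r * h r) (star X * X) := by congr 1; ext r; ring
      _ = cfc h (star X * X) * (star X * X) * cfc h (star X * X) := by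
        rw [cfc_mul (fun r => h r * r) h _ (by fun_prop) ch.continuousOn,
          cfc_mul h (fun r => r) _ ch.continuousOn (by fun_prop), cfc_id' ..]
      _ = _ := by noncomm_ring
  · rw [← mul_cfc_star_mul_self_mul_star X g hg, ← e,
      cfc_mul h h _ ch.continuousOn ch.continuousOn]
    noncomm_ring

/-- Although `X⁺ ≤ Y` can fail, compressing by `G = g_n(X)`, a continuous stand-in for the spectral
projection of `X` on the positive axis, gives `GXG ≤ GYG`, and `τ(GYG) ≤ τ(Y)` because `G` is a
contraction. The operators `GXG` increase to `X⁺` in norm, so normality concludes. -/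
theorem posPart_le {X Y : H →L[ℂ] H} (hX : X ∈ N) (hY : Y ∈ N) (hXs : IsSelfAdjoint X)
    (hY0 : 0 ≤ Y) (hXY : X ≤ Y) : τ.toFun X⁺ ≤ τ.toFun Y := by
  have e : X⁺ = cfc (fun x : ℝ => x⁺) X := by
    rw [CFC.posPart_def, cfcₙ_eq_cfc]
  set g : ℕ → ℝ → ℝ := fun n x => Real.sqrt (min 1 ((n + 1) * x⁺)) with hg
  have cg (n : ℕ) : Continuous (g n) := by simp only [hg, posPart_def]; fun_prop
  have gg (n : ℕ) (x : ℝ) : g n x * x * g n x = min 1 ((n + 1) * x⁺) * x := by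
    have : g n x * g n x = min 1 ((n + 1) * x⁺) := Real.mul_self_sqrt (by positivity)
    rw [← this]; ring
  have gg0 (n : ℕ) (x : ℝ) : 0 ≤ g n x * x * g n x := by
    rw [gg]
    rcases le_total 0 x with hx | hx
    · positivity
    · simp [posPart_eq_zero.2 hx]
  rw [e]
  refine τ.cfc_le_of_tendsto hX (h := fun n x => g n x * x * g n x)
    (ε := fun n : ℕ => 1 / ((n : ℝ) + 1))
    (fun n => ((cg n).mul continuous_id).mul (cg n)) (by simp only [posPart_def]; fun_prop)
    (fun n x _ => gg0 n x) ?_ tendsto_one_div_add_atTop_nhds_zero_nat ?_ ?_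
  · intro n x _
    simp only [gg]
    rcases le_total 0 x with hx | hx
    · gcongr
      simp
    · simp [posPart_eq_zero.2 hx]
  · intro n x _
    simp only [gg]
    have hn : (0 : ℝ) < n + 1 := by positivity
    rcases le_total 0 x with hx | hx
    · rw [posPart_eq_self.2 hx]
      rcases le_total 1 ((n + 1) * x) with h | h
      · rw [min_eq_left h]; simp; positivity
      · have h1 : x ≤ 1 / (n + 1) := by rw [le_div_iff₀ hn]; linarith
        have h2 : 0 ≤ ((n : ℝ) + 1) * x * x := by positivity
        have h3 : ((n : ℝ) + 1) * x * x ≤ 1 * x := by gcongr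
        rw [min_eq_right h, abs_le]
        constructor <;> linarith
    · simp [posPart_eq_zero.2 hx]; positivity
  · intro n
    have sg : star (cfc (g n) X) = cfc (g n) X := (cfc_predicate (g n) X : IsSelfAdjoint _)
    have e1 : cfc (fun x => g n x * x * g n x) X = cfc (g n) X * X * star (cfc (g n) X) := by
      rw [cfc_mul (fun r => g n r * r) (g n) _ ((cg n).mul continuous_id).continuousOn
        (cg n).continuousOn, cfc_mul (g n) (fun r => r) _ (cg n).continuousOn (by fun_prop),
        cfc_id' .., sg]
    have h0 : 0 ≤ cfc (fun x => g n x * x * g n x) X := cfc_nonneg fun x _ => gg0 n x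
    have hG : cfc (g n) X ∈ N := cfc_mem hX _
    have hG1 : star (cfc (g n) X) * cfc (g n) X ≤ 1 := by
      rw [sg, ← cfc_mul (g n) (g n) X (cg n).continuousOn (cg n).continuousOn]
      refine cfc_le_one _ _ fun x _ => ?_
      have : g n x * g n x = min 1 ((n + 1) * x⁺) := Real.mul_self_sqrt (by positivity)
      rw [this]
      exact min_le_left _ _
    rw [e1] at h0 ⊢
    exact (τ.mono (mul_mem (mul_mem hG hX) (star_mem hG)) (mul_mem (mul_mem hG hY) (star_mem hG))
      h0 (star_right_conjugate_le_conjugate hXY _)).trans (τ.conj_le hG hY hY0 hG1)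

/-- With `a = X*X` and `E_n = a (a + 1/(n+1))⁻¹`, the contractions `E_n` satisfy `E_n a → a` in
norm. Hence they converge strongly to the identity on the closure of the range of `a`, which is the
orthogonal complement of the kernel of `X`. This makes support projections accessible to normality.
-/
theorem isLUB_cfc_star_mul_self_div (X : H →L[ℂ] H) :
    IsLUB (Set.range fun n : ℕ =>
        cfc (fun x : ℝ => x * (max x 0 + 1 / ((n : ℝ) + 1))⁻¹) (star X * X))
      (1 - (X.ker).starProjection) := by
  set q := (X.ker).starProjection with hq
  set a := star X * X with ha
  have a0 : 0 ≤ a := star_mul_self_nonneg X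
  have sa : IsSelfAdjoint a := .star_mul_self X
  have hqq : IsStarProjection (1 - q) := isStarProjection_starProjection.one_sub
  have haq : a * q = 0 := by
    have hXq : X * q = 0 := by
      ext v
      exact (Submodule.starProjection_apply_mem X.ker v : _)
    rw [ha, mul_assoc, hXq, mul_zero]
  have hc (n : ℕ) : Continuous fun x : ℝ => (max x 0 + 1 / ((n : ℝ) + 1))⁻¹ :=
    Continuous.inv₀ (by fun_prop) fun x => by positivity
  have hc' (n : ℕ) : Continuous fun x : ℝ => x * (max x 0 + 1 / ((n : ℝ) + 1))⁻¹ :=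
    continuous_id.mul (hc n)
  set E : ℕ → H →L[ℂ] H := fun n =>
    cfc (fun x : ℝ => x * (max x 0 + 1 / ((n : ℝ) + 1))⁻¹) a with hE
  have hnonneg (n : ℕ) {x : ℝ} (hx : x ∈ spectrum ℝ a) :
      0 ≤ x * (max x 0 + 1 / ((n : ℝ) + 1))⁻¹ := by
    have hx0 : 0 ≤ x := spectrum_nonneg_of_nonneg a0 hx
    positivity
  have hle1 (n : ℕ) {x : ℝ} (hx : x ∈ spectrum ℝ a) :
      x * (max x 0 + 1 / ((n : ℝ) + 1))⁻¹ ≤ 1 := by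
    have hx0 : 0 ≤ x := spectrum_nonneg_of_nonneg a0 hx
    rw [mul_inv_le_iff₀ (by positivity), max_eq_left hx0]
    have : (0 : ℝ) ≤ 1 / ((n : ℝ) + 1) := by positivity
    linarith
  have E0 (n : ℕ) : 0 ≤ E n := cfc_nonneg fun x hx => hnonneg n hx
  have E1 (n : ℕ) : E n ≤ 1 := cfc_le_one _ _ fun x hx => hle1 n hx
  have En (n : ℕ) : ‖E n‖ ≤ 1 := (CStarAlgebra.norm_le_one_iff_of_nonneg _ (E0 n)).2 (E1 n)
  have Eq (n : ℕ) : E n * q = 0 := by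
    have : E n = cfc (fun x : ℝ => (max x 0 + 1 / ((n : ℝ) + 1))⁻¹) a * a := by
      simp only [hE]
      rw [cfc_mul (fun x : ℝ => x) _ _ continuousOn_id (hc n).continuousOn,
        (cfc_commute_cfc (fun x : ℝ => x) _ a).eq, cfc_id' ..]
    rw [this, mul_assoc, haq, mul_zero]
  have Er (n : ℕ) : E n * (1 - q) = E n := by rw [mul_sub, Eq, mul_one, sub_zero]
  have rE (n : ℕ) : (1 - q) * E n = E n := by
    have := congr(star $(Er n))
    rwa [star_mul, hqq.isSelfAdjoint.star_eq, (E0 n).isSelfAdjoint.star_eq] at this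
  have Ea (n : ℕ) : ‖E n * a - a‖ ≤ 1 / ((n : ℝ) + 1) := by
    have : E n * a - a =
        cfc (fun x : ℝ => x * (max x 0 + 1 / ((n : ℝ) + 1))⁻¹ * x - x) a := by
      rw [cfc_sub (fun x : ℝ => x * (max x 0 + 1 / ((n : ℝ) + 1))⁻¹ * x) (fun x => x) a
          ((hc' n).mul continuous_id).continuousOn continuousOn_id,
        cfc_mul (fun x : ℝ => x * (max x 0 + 1 / ((n : ℝ) + 1))⁻¹) (fun x => x) a
          (hc' n).continuousOn continuousOn_id, cfc_id' ..]
    rw [this]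
    refine norm_cfc_le (by positivity) fun x hx => ?_
    have hx0 : 0 ≤ x := spectrum_nonneg_of_nonneg a0 hx
    have hn : (0 : ℝ) < 1 / ((n : ℝ) + 1) := by positivity
    have hd : x * (max x 0 + 1 / ((n : ℝ) + 1))⁻¹ * x - x =
        -(1 / ((n : ℝ) + 1) * (x * (max x 0 + 1 / ((n : ℝ) + 1))⁻¹)) := by
      rw [max_eq_left hx0]
      field_simp
      ring
    rw [hd, norm_neg, Real.norm_of_nonneg (mul_nonneg hn.le (hnonneg n hx))]
    exact mul_le_of_le_one_right hn.le (hle1 n hx)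
  have hlim (v : H) : Filter.Tendsto (fun n => E n v) Filter.atTop (nhds ((1 - q) v)) := by
    set u := (1 - q) v with hu
    have hEu (n : ℕ) : E n v = E n u := by
      rw [hu]; exact (congr($(Er n) v)).symm
    have hmem : u ∈ closure (Set.range a) := by
      have h1 : u ∈ (a.ker)ᗮ := by
        have : a.ker = X.ker := X.ker_adjoint_comp_self
        rw [this, hu]
        exact Submodule.sub_starProjection_mem_orthogonal v
      rw [ContinuousLinearMap.orthogonal_ker] at h1
      have h2 : ContinuousLinearMap.adjoint a = a := sa
      rw [h2] at h1
      exact h1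
    rw [Metric.tendsto_atTop]
    intro ε hε
    obtain ⟨_, ⟨w, rfl⟩, hw⟩ := Metric.mem_closure_iff.1 hmem (ε / 3) (by positivity)
    obtain ⟨n₀, hn₀⟩ := exists_nat_one_div_lt (show 0 < ε / 3 / (‖w‖ + 1) by positivity)
    refine ⟨n₀, fun n hn => ?_⟩
    rw [hEu, dist_eq_norm]
    rw [dist_eq_norm] at hw
    have h1 : ‖E n (u - a w)‖ ≤ ‖u - a w‖ :=
      ((E n).le_opNorm _).trans (mul_le_of_le_one_left (norm_nonneg _) (En n))
    have h2 : ‖(E n * a - a) w‖ < ε / 3 := by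
      refine (((E n * a - a)).le_opNorm _).trans_lt ?_
      have h3 : ‖E n * a - a‖ ≤ 1 / ((n₀ : ℝ) + 1) := (Ea n).trans (by gcongr)
      have h4 := (lt_div_iff₀ (by positivity : 0 < ‖w‖ + 1)).1 hn₀
      have h5 : (0 : ℝ) < 1 / ((n₀ : ℝ) + 1) := by positivity
      nlinarith [norm_nonneg w, norm_nonneg (E n * a - a)]
    have e : E n u - u = E n (u - a w) + (E n * a - a) w + -(u - a w) := by
      simp
    rw [e]
    refine (norm_add₃_le).trans_lt ?_
    rw [norm_neg]
    linarith
  constructor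
  · rintro _ ⟨n, rfl⟩
    have := star_left_conjugate_le_conjugate (E1 n) (1 - q)
    rwa [hqq.isSelfAdjoint.star_eq, rE, Er, mul_one, hqq.isIdempotentElem.eq] at this
  · intro R hR
    have hRE (n : ℕ) : E n ≤ R := hR ⟨n, rfl⟩
    have R0 : 0 ≤ R := (E0 0).trans (hRE 0)
    rw [ContinuousLinearMap.le_def, ContinuousLinearMap.isPositive_def']
    refine ⟨R0.isSelfAdjoint.sub hqq.isSelfAdjoint, fun v => ?_⟩
    have h1 (n : ℕ) : 0 ≤ RCLike.re (inner ℂ ((R - E n) v) v) :=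
      ((ContinuousLinearMap.le_def _ _).1 (hRE n)).2 v
    have h2 : Filter.Tendsto (fun n => RCLike.re (inner ℂ ((R - E n) v) v)) Filter.atTop
        (nhds (RCLike.re (inner ℂ ((R - (1 - q)) v) v))) := by
      refine (RCLike.continuous_re.tendsto _).comp ?_
      exact ((tendsto_const_nhds.sub (hlim v)).inner tendsto_const_nhds)
    exact ge_of_tendsto h2 (.of_forall h1)

/-- Pulling back a projection along an operator does not increase the trace of the complement. -/
theorem exists_projection_mul_eq_zero {p Y : H →L[ℂ] H} (hp : p ∈ N) (hpp : IsStarProjection p)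
    (hY : Y ∈ N) : ∃ q ∈ N, IsStarProjection q ∧ (1 - p) * Y * q = 0 ∧
      τ.toFun (1 - q) ≤ τ.toFun (1 - p) := by
  set X := (1 - p) * Y with hXdef
  have hX : X ∈ N := mul_mem (sub_mem (one_mem N) hp) hY
  have hq : IsStarProjection (X.ker).starProjection := isStarProjection_starProjection
  have hqN : (X.ker).starProjection ∈ N := by
    -- A projection lies in `N` as soon as the commutant leaves its range invariant; here the range
    -- is the kernel of an element of `N`.
    rw [IsStarProjection.mem_iff hq]
    intro y hy v hv
    have hc : X * y = y * X := mem_commutant_iff.1 hy X hX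
    simp only [Submodule.range_starProjection] at hv ⊢
    have hv' : X v = 0 := hv
    change X (y v) = 0
    have := congr($hc v)
    simpa [hv'] using this
  refine ⟨_, hqN, hq, ?_, ?_⟩
  · ext v
    exact (Submodule.starProjection_apply_mem X.ker v : _)
  · have hpp' : IsStarProjection (1 - p) := hpp.one_sub
    have hlub := isLUB_cfc_star_mul_self_div X
    have hc (n : ℕ) : Continuous fun x : ℝ => (max x 0 + 1 / ((n : ℝ) + 1))⁻¹ :=
      Continuous.inv₀ (by fun_prop) fun x => by positivity
    have aN : star X * X ∈ N := mul_mem (star_mem hX) hX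
    have hmono : Monotone fun n : ℕ =>
        cfc (fun x : ℝ => x * (max x 0 + 1 / ((n : ℝ) + 1))⁻¹) (star X * X) := by
      refine monotone_nat_of_le_succ fun n => cfc_mono (fun x hx => ?_)
        (continuous_id.mul (hc n)).continuousOn (continuous_id.mul (hc _)).continuousOn
      have hx0 : 0 ≤ x := spectrum_nonneg_of_nonneg (star_mul_self_nonneg X) hx
      gcongr
      simp
    rw [τ.normal' _ ?_ (Set.range_nonempty _) hmono.directed_le.directedOn_range _
      (sub_mem (one_mem N) hqN) hlub]
    · simp only [Set.mem_range, iSup_exists, iSup_le_iff]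
      rintro _ n rfl
      -- Passing from `X*X` to `XX*`: functions of the latter that vanish at `0` live under `1 - p`,
      -- since `(1 - p) X = X`.
      rw [τ.cfc_star_mul_self hX (hc n) (fun x => by positivity)]
      have sb : IsSelfAdjoint (X * star X) := .mul_star_self X
      set F := cfc (fun x : ℝ => x * (max x 0 + 1 / ((n : ℝ) + 1))⁻¹) (X * star X) with hF
      have F0 : 0 ≤ F := cfc_nonneg fun x hx => by
        have hx0 : 0 ≤ x := spectrum_nonneg_of_nonneg (mul_star_self_nonneg X) hx
        positivity
      have F1 : F ≤ 1 := cfc_le_one _ _ fun x hx => by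
        have hx0 : 0 ≤ x := spectrum_nonneg_of_nonneg (mul_star_self_nonneg X) hx
        rw [mul_inv_le_iff₀ (by positivity), max_eq_left hx0]
        have : (0 : ℝ) ≤ 1 / ((n : ℝ) + 1) := by positivity
        linarith
      have hpX : (1 - p) * X = X := by
        rw [hXdef, ← mul_assoc, hpp'.isIdempotentElem.eq]
      have hpF : (1 - p) * F = F := by
        rw [hF, cfc_mul (fun x : ℝ => x) _ _ continuousOn_id (hc n).continuousOn, cfc_id' ..,
          ← mul_assoc, ← mul_assoc, hpX]
      have hFp : F * (1 - p) = F := by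
        have := congr(star $hpF)
        rwa [star_mul, hpp'.isSelfAdjoint.star_eq, F0.isSelfAdjoint.star_eq] at this
      refine τ.mono (cfc_mem (mul_mem hX (star_mem hX)) _) (sub_mem (one_mem N) hp) F0 ?_
      have := star_left_conjugate_le_conjugate F1 (1 - p)
      rwa [hpp'.isSelfAdjoint.star_eq, hpF, hFp, mul_one, hpp'.isIdempotentElem.eq] at this
    · rintro _ ⟨n, rfl⟩
      refine ⟨cfc_mem aN _, cfc_nonneg fun x hx => ?_⟩
      have hx0 : 0 ≤ x := spectrum_nonneg_of_nonneg (star_mul_self_nonneg X) hx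
      positivity

end FNSTrace

end Trace

/-! ### Linear extension of tracial functionals from a hereditary cone. -/

section TracialFunctional

variable {H : Type*} [NormedAddCommGroup H] [InnerProductSpace ℂ H] [CompleteSpace H]

/-- An additive real functional, invariant under `X* X ↦ X X*`, on a hereditary cone of positive
elements of a von Neumann algebra. -/
structure TracialFunctional (N : VonNeumannAlgebra H) where
  cone : Set (H →L[ℂ] H)
  val : (H →L[ℂ] H) → ℝ
  mem_alg : ∀ P ∈ cone, P ∈ N
  nonneg : ∀ P ∈ cone, 0 ≤ P
  zero_mem : 0 ∈ cone
  add_mem : ∀ P ∈ cone, ∀ Q ∈ cone, P + Q ∈ cone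
  posPart_mem : ∀ P ∈ cone, ∀ X ∈ N, IsSelfAdjoint X → X ≤ P → X⁺ ∈ cone
  swap_mem : ∀ X ∈ N, star X * X ∈ cone → X * star X ∈ cone
  val_add : ∀ P ∈ cone, ∀ Q ∈ cone, val (P + Q) = val P + val Q
  val_swap : ∀ X ∈ N, star X * X ∈ cone → val (star X * X) = val (X * star X)

namespace TracialFunctional

variable {N : VonNeumannAlgebra H} (φ : TracialFunctional N)

open VonNeumannAlgebra

/-- The operators of `N` all of whose four positive parts lie in the cone. -/
def domain : Set (H →L[ℂ] H) := {A | A ∈ N ∧ JordanForall (· ∈ φ.cone) A}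

/-- The extension of the functional to its domain. -/
noncomputable def ext (A : H →L[ℂ] H) : ℂ := jordanExtend (fun P => (φ.val P : ℂ)) A

variable {φ}

theorem mem_of_le {P Q : H →L[ℂ] H} (hP : P ∈ φ.cone) (hQ : Q ∈ N) (h0 : 0 ≤ Q) (h : Q ≤ P) :
    Q ∈ φ.cone := by
  have := φ.posPart_mem P hP Q hQ h0.isSelfAdjoint h
  rwa [(CFC.posPart_eq_self Q).2 h0] at this

theorem nsmul_mem {P : H →L[ℂ] H} (hP : P ∈ φ.cone) (n : ℕ) : n • P ∈ φ.cone := by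
  induction n with
  | zero => simpa using φ.zero_mem
  | succ n ih => rw [succ_nsmul]; exact φ.add_mem _ ih _ hP

theorem val_nsmul {P : H →L[ℂ] H} (hP : P ∈ φ.cone) (n : ℕ) : φ.val (n • P) = n * φ.val P := by
  induction n with
  | zero =>
    have := φ.val_add 0 φ.zero_mem 0 φ.zero_mem
    rw [add_zero] at this
    simp only [zero_nsmul, Nat.cast_zero, zero_mul]
    linarith
  | succ n ih => rw [succ_nsmul, φ.val_add _ (nsmul_mem hP n) _ hP, ih]; push_cast; ring

/-- The cone axiom is stated for positive parts because `(P - Q)⁺ ≤ P` is false in general, so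
ordinary heredity would not apply here. -/
theorem posPart_sub_mem {P Q : H →L[ℂ] H} (hP : P ∈ φ.cone) (hQ : Q ∈ φ.cone) :
    (P - Q)⁺ ∈ φ.cone :=
  φ.posPart_mem P hP _ (sub_mem (φ.mem_alg P hP) (φ.mem_alg Q hQ))
    ((φ.nonneg P hP).isSelfAdjoint.sub (φ.nonneg Q hQ).isSelfAdjoint)
    (sub_le_self _ (φ.nonneg Q hQ))

theorem negPart_sub_mem {P Q : H →L[ℂ] H} (hP : P ∈ φ.cone) (hQ : Q ∈ φ.cone) :
    (P - Q)⁻ ∈ φ.cone := by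
  rw [← CFC.posPart_neg, neg_sub]
  exact posPart_sub_mem hQ hP

/-- Additivity applied to `(P - Q)⁺ + Q = P + (P - Q)⁻`. The value on a difference thus does not
depend on its representation, which makes the extension linear. -/
theorem val_posPart_sub_val_negPart {P Q : H →L[ℂ] H} (hP : P ∈ φ.cone) (hQ : Q ∈ φ.cone) :
    φ.val (P - Q)⁺ - φ.val (P - Q)⁻ = φ.val P - φ.val Q := by
  have h1 := posPart_sub_mem hP hQ
  have h2 := negPart_sub_mem hP hQ
  have e : (P - Q)⁺ + Q = P + (P - Q)⁻ := by
    have := CFC.posPart_sub_negPart (P - Q)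
      ((φ.nonneg P hP).isSelfAdjoint.sub (φ.nonneg Q hQ).isSelfAdjoint)
    rw [← sub_eq_sub_iff_add_eq_add, this]
  have := congr(φ.val $e)
  rw [φ.val_add _ h1 _ hQ, φ.val_add _ hP _ h2] at this
  linarith

theorem realPart_add_I_smul {X Y : H →L[ℂ] H} (hX : IsSelfAdjoint X) (hY : IsSelfAdjoint Y) :
    (ℜ (X + Complex.I • Y) : H →L[ℂ] H) = X := by
  rw [map_add, realPart_I_smul, hY.imaginaryPart, neg_zero, add_zero, hX.coe_realPart]

theorem imaginaryPart_add_I_smul {X Y : H →L[ℂ] H} (hX : IsSelfAdjoint X)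
    (hY : IsSelfAdjoint Y) : (ℑ (X + Complex.I • Y) : H →L[ℂ] H) = Y := by
  rw [map_add, imaginaryPart_I_smul, hX.imaginaryPart, zero_add, hY.coe_realPart]

theorem isSelfAdjoint_sub {P Q : H →L[ℂ] H} (hP : P ∈ φ.cone) (hQ : Q ∈ φ.cone) :
    IsSelfAdjoint (P - Q) :=
  (φ.nonneg P hP).isSelfAdjoint.sub (φ.nonneg Q hQ).isSelfAdjoint

theorem combination_mem {P₁ P₂ P₃ P₄ : H →L[ℂ] H} (h₁ : P₁ ∈ φ.cone) (h₂ : P₂ ∈ φ.cone)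
    (h₃ : P₃ ∈ φ.cone) (h₄ : P₄ ∈ φ.cone) :
    (P₁ - P₂) + Complex.I • (P₃ - P₄) ∈ φ.domain := by
  refine ⟨AddMemClass.add_mem (sub_mem (φ.mem_alg _ h₁) (φ.mem_alg _ h₂))
    (complex_smul_mem _ (sub_mem (φ.mem_alg _ h₃) (φ.mem_alg _ h₄))), ?_⟩
  unfold JordanForall
  rw [realPart_add_I_smul (isSelfAdjoint_sub h₁ h₂) (isSelfAdjoint_sub h₃ h₄),
    imaginaryPart_add_I_smul (isSelfAdjoint_sub h₁ h₂) (isSelfAdjoint_sub h₃ h₄)]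
  exact ⟨posPart_sub_mem h₁ h₂, negPart_sub_mem h₁ h₂, posPart_sub_mem h₃ h₄,
    negPart_sub_mem h₃ h₄⟩

theorem ext_combination {P₁ P₂ P₃ P₄ : H →L[ℂ] H} (h₁ : P₁ ∈ φ.cone) (h₂ : P₂ ∈ φ.cone)
    (h₃ : P₃ ∈ φ.cone) (h₄ : P₄ ∈ φ.cone) :
    φ.ext ((P₁ - P₂) + Complex.I • (P₃ - P₄)) =
      (φ.val P₁ - φ.val P₂) + Complex.I * (φ.val P₃ - φ.val P₄) := by
  unfold ext jordanExtend
  rw [realPart_add_I_smul (isSelfAdjoint_sub h₁ h₂) (isSelfAdjoint_sub h₃ h₄),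
    imaginaryPart_add_I_smul (isSelfAdjoint_sub h₁ h₂) (isSelfAdjoint_sub h₃ h₄)]
  have e1 := val_posPart_sub_val_negPart h₁ h₂
  have e2 := val_posPart_sub_val_negPart h₃ h₄
  simp only [← Complex.ofReal_sub, e1, e2]

theorem exists_combination {A : H →L[ℂ] H} (hA : A ∈ φ.domain) :
    ∃ P₁ ∈ φ.cone, ∃ P₂ ∈ φ.cone, ∃ P₃ ∈ φ.cone, ∃ P₄ ∈ φ.cone,
      A = (P₁ - P₂) + Complex.I • (P₃ - P₄) := by
  refine ⟨_, hA.2.1, _, hA.2.2.1, _, hA.2.2.2.1, _, hA.2.2.2.2, ?_⟩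
  rw [smul_sub]
  exact (CStarAlgebra.linear_combination_nonneg A).symm

theorem val_zero : φ.val 0 = 0 := by simpa using val_nsmul φ.zero_mem 0

theorem ext_of_mem {P : H →L[ℂ] H} (hP : P ∈ φ.cone) : φ.ext P = φ.val P := by
  simpa [val_zero] using ext_combination hP φ.zero_mem φ.zero_mem φ.zero_mem

theorem add_mem_domain {A B : H →L[ℂ] H} (hA : A ∈ φ.domain) (hB : B ∈ φ.domain) :
    A + B ∈ φ.domain ∧ φ.ext (A + B) = φ.ext A + φ.ext B := by
  obtain ⟨P₁, h₁, P₂, h₂, P₃, h₃, P₄, h₄, rfl⟩ := exists_combination hA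
  obtain ⟨Q₁, k₁, Q₂, k₂, Q₃, k₃, Q₄, k₄, rfl⟩ := exists_combination hB
  have e : (P₁ - P₂) + Complex.I • (P₃ - P₄) + ((Q₁ - Q₂) + Complex.I • (Q₃ - Q₄)) =
      ((P₁ + Q₁) - (P₂ + Q₂)) + Complex.I • ((P₃ + Q₃) - (P₄ + Q₄)) := by
    module
  have m₁ := φ.add_mem _ h₁ _ k₁
  have m₂ := φ.add_mem _ h₂ _ k₂
  have m₃ := φ.add_mem _ h₃ _ k₃
  have m₄ := φ.add_mem _ h₄ _ k₄
  rw [e]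
  refine ⟨combination_mem m₁ m₂ m₃ m₄, ?_⟩
  rw [ext_combination m₁ m₂ m₃ m₄, ext_combination h₁ h₂ h₃ h₄, ext_combination k₁ k₂ k₃ k₄,
    φ.val_add _ h₁ _ k₁, φ.val_add _ h₂ _ k₂, φ.val_add _ h₃ _ k₃, φ.val_add _ h₄ _ k₄]
  push_cast
  ring

theorem neg_mem_domain {A : H →L[ℂ] H} (hA : A ∈ φ.domain) :
    -A ∈ φ.domain ∧ φ.ext (-A) = -φ.ext A := by
  obtain ⟨P₁, h₁, P₂, h₂, P₃, h₃, P₄, h₄, rfl⟩ := exists_combination hA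
  have e : -((P₁ - P₂) + Complex.I • (P₃ - P₄)) = (P₂ - P₁) + Complex.I • (P₄ - P₃) := by module
  rw [e]
  refine ⟨combination_mem h₂ h₁ h₄ h₃, ?_⟩
  rw [ext_combination h₁ h₂ h₃ h₄, ext_combination h₂ h₁ h₄ h₃]
  ring

theorem I_smul_mem_domain {A : H →L[ℂ] H} (hA : A ∈ φ.domain) :
    Complex.I • A ∈ φ.domain ∧ φ.ext (Complex.I • A) = Complex.I * φ.ext A := by
  obtain ⟨P₁, h₁, P₂, h₂, P₃, h₃, P₄, h₄, rfl⟩ := exists_combination hA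
  have e : Complex.I • ((P₁ - P₂) + Complex.I • (P₃ - P₄)) =
      (P₄ - P₃) + Complex.I • (P₁ - P₂) := by
    rw [smul_add, smul_smul, Complex.I_mul_I]
    module
  rw [e]
  refine ⟨combination_mem h₄ h₃ h₁ h₂, ?_⟩
  rw [ext_combination h₁ h₂ h₃ h₄, ext_combination h₄ h₃ h₁ h₂]
  linear_combination (-(φ.val P₃ : ℂ) + φ.val P₄) * Complex.I_mul_I

theorem jordan_combination_mem_domain {A₁ A₂ A₃ A₄ : H →L[ℂ] H} (h₁ : A₁ ∈ φ.domain)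
    (h₂ : A₂ ∈ φ.domain) (h₃ : A₃ ∈ φ.domain) (h₄ : A₄ ∈ φ.domain) :
    (A₁ - A₂) + Complex.I • (A₃ - A₄) ∈ φ.domain ∧
      φ.ext ((A₁ - A₂) + Complex.I • (A₃ - A₄)) =
        (φ.ext A₁ - φ.ext A₂) + Complex.I * (φ.ext A₃ - φ.ext A₄) := by
  have a := add_mem_domain h₁ (neg_mem_domain h₂).1
  have b := add_mem_domain h₃ (neg_mem_domain h₄).1
  have c := I_smul_mem_domain b.1
  have d := add_mem_domain a.1 c.1
  simp only [sub_eq_add_neg]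
  exact ⟨d.1, by rw [d.2, a.2, c.2, b.2, (neg_mem_domain h₂).2, (neg_mem_domain h₄).2]⟩

/-- Polarisation: `X*Z` and `ZX*` are the same combination of the `W*W` and the `WW*`, with `W = (X
+ cZ)/2` and `c = 1, -1, -i, i`. The functional does not distinguish `W*W` from `WW*`. -/
theorem star_mul_mem_domain {X Z : H →L[ℂ] H} (hX : X ∈ N) (hZ : Z ∈ N)
    (hXX : star X * X ∈ φ.cone) (hZZ : star Z * Z ∈ φ.cone) :
    star X * Z ∈ φ.domain ∧ φ.ext (star X * Z) = φ.ext (Z * star X) := by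
  have key (c : ℂ) (hc : ‖c‖ = 1) :
      let W := (2⁻¹ : ℝ) • (X + c • Z)
      W ∈ N ∧ star W * W ∈ φ.cone := by
    intro W
    have hW : W ∈ N := real_smul_mem _ (AddMemClass.add_mem hX (complex_smul_mem c hZ))
    refine ⟨hW, mem_of_le (φ.add_mem _ hXX _ hZZ) (mul_mem (star_mem hW) hW)
      (star_mul_self_nonneg _) ?_⟩
    have hcc : star c * c = 1 := by
      have := Complex.conj_mul' c
      simpa [hc] using this
    -- Parallelogram law: this positive sum equals `X*X + Z*Z - W*W`.
    have h0 : 0 ≤ star ((2⁻¹ : ℝ) • (X - c • Z)) * ((2⁻¹ : ℝ) • (X - c • Z)) +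
        (2⁻¹ : ℝ) • (star X * X + star Z * Z) :=
      add_nonneg (star_mul_self_nonneg _) (smul_nonneg (by norm_num)
        (add_nonneg (star_mul_self_nonneg _) (star_mul_self_nonneg _)))
    rw [← sub_nonneg]
    convert h0 using 1
    have e : star (c • Z) * (c • Z) = star Z * Z := by
      rw [star_smul, smul_mul_smul_comm, hcc, one_smul]
    simp only [W, star_smul (2⁻¹ : ℝ), star_trivial, star_add, star_sub, smul_mul_smul_comm,
      add_mul, mul_add, sub_mul, mul_sub]
    rw [e]
    module
  obtain ⟨n₁, m₁⟩ := key 1 (by simp)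
  obtain ⟨n₂, m₂⟩ := key (-1) (by simp)
  obtain ⟨n₃, m₃⟩ := key (-Complex.I) (by simp)
  obtain ⟨n₄, m₄⟩ := key Complex.I (by simp)
  set W₁ := (2⁻¹ : ℝ) • (X + (1 : ℂ) • Z) with hW₁
  set W₂ := (2⁻¹ : ℝ) • (X + (-1 : ℂ) • Z) with hW₂
  set W₃ := (2⁻¹ : ℝ) • (X + (-Complex.I) • Z) with hW₃
  set W₄ := (2⁻¹ : ℝ) • (X + Complex.I • Z) with hW₄
  have D (c : ℂ) : star ((2⁻¹ : ℝ) • (X + c • Z)) * ((2⁻¹ : ℝ) • (X + c • Z)) =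
      (4⁻¹ : ℂ) • (star X * X + c • (star X * Z) + star c • (star Z * X) +
        (star c * c) • (star Z * Z)) := by
    simp only [star_smul (2⁻¹ : ℝ), star_trivial, star_add, star_smul c, add_mul, mul_add,
      mul_smul_comm, smul_mul_assoc]
    simp only [← Complex.coe_smul]
    push_cast
    module
  have D' (c : ℂ) : ((2⁻¹ : ℝ) • (X + c • Z)) * star ((2⁻¹ : ℝ) • (X + c • Z)) =
      (4⁻¹ : ℂ) • (X * star X + c • (Z * star X) + star c • (X * star Z) +
        (star c * c) • (Z * star Z)) := by
    simp only [star_smul (2⁻¹ : ℝ), star_trivial, star_add, star_smul c, add_mul, mul_add,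
      mul_smul_comm, smul_mul_assoc]
    simp only [← Complex.coe_smul]
    push_cast
    module
  have e₁ : star X * Z = (star W₁ * W₁ - star W₂ * W₂) +
      Complex.I • (star W₃ * W₃ - star W₄ * W₄) := by
    rw [hW₁, hW₂, hW₃, hW₄, D, D, D, D]
    simp only [star_neg, star_one, RCLike.star_def, Complex.conj_I]
    match_scalars <;> ring_nf <;> simp <;> norm_num
  have e₂ : Z * star X = (W₁ * star W₁ - W₂ * star W₂) +
      Complex.I • (W₃ * star W₃ - W₄ * star W₄) := by
    rw [hW₁, hW₂, hW₃, hW₄, D', D', D', D']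
    simp only [star_neg, star_one, RCLike.star_def, Complex.conj_I]
    match_scalars <;> ring_nf <;> simp <;> norm_num
  refine ⟨e₁ ▸ combination_mem m₁ m₂ m₃ m₄, ?_⟩
  rw [e₁, e₂, ext_combination m₁ m₂ m₃ m₄,
    ext_combination (φ.swap_mem _ n₁ m₁) (φ.swap_mem _ n₂ m₂) (φ.swap_mem _ n₃ m₃)
      (φ.swap_mem _ n₄ m₄), φ.val_swap _ n₁ m₁, φ.val_swap _ n₂ m₂, φ.val_swap _ n₃ m₃,
    φ.val_swap _ n₄ m₄]

theorem sqrt_conj_mem {P b : H →L[ℂ] H} (hP : P ∈ φ.cone) (hb : b ∈ N) (hb0 : 0 ≤ b) :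
    CFC.sqrt P * b * CFC.sqrt P ∈ φ.cone := by
  have sP : star (CFC.sqrt P) = CFC.sqrt P := (CFC.sqrt_nonneg P).isSelfAdjoint
  have hsN : CFC.sqrt P ∈ N := sqrt_mem (φ.mem_alg P hP)
  obtain ⟨n, hn⟩ := exists_nat_ge ‖b‖
  refine mem_of_le (nsmul_mem hP n) (mul_mem (mul_mem hsN hb) hsN) ?_ ?_
  · have := star_left_conjugate_nonneg hb0 (CFC.sqrt P)
    rwa [sP] at this
  · have h1 : b ≤ (n : H →L[ℂ] H) := (CStarAlgebra.norm_le_natCast_iff_of_nonneg b n hb0).1 hn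
    have := star_left_conjugate_le_conjugate h1 (CFC.sqrt P)
    rw [sP] at this
    refine this.trans_eq ?_
    rw [← (Nat.cast_commute n (CFC.sqrt P)).eq, mul_assoc,
      CFC.sqrt_mul_sqrt_self P (φ.nonneg P hP), nsmul_eq_mul]

/-- Factor `Pb` as `P^{1/2} · (P^{1/2} b)` and exchange the factors. -/
theorem mul_mem_domain_of_nonneg {P b : H →L[ℂ] H} (hP : P ∈ φ.cone) (hb : b ∈ N) (hb0 : 0 ≤ b) :
    P * b ∈ φ.domain ∧ φ.ext (P * b) = φ.val (CFC.sqrt P * b * CFC.sqrt P) := by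
  have sP : star (CFC.sqrt P) = CFC.sqrt P := (CFC.sqrt_nonneg P).isSelfAdjoint
  have hsN : CFC.sqrt P ∈ N := sqrt_mem (φ.mem_alg P hP)
  have hss : CFC.sqrt P * CFC.sqrt P = P := CFC.sqrt_mul_sqrt_self P (φ.nonneg P hP)
  have hXX : star (CFC.sqrt P) * CFC.sqrt P ∈ φ.cone := by rwa [sP, hss]
  have hZZ : star (CFC.sqrt P * b) * (CFC.sqrt P * b) ∈ φ.cone := by
    -- The product in question is `bPb`; its swap `P^{1/2} b b* P^{1/2}` is dominated by a multiple
    -- of `P`.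
    have h := φ.swap_mem (star (CFC.sqrt P * b)) (star_mem (mul_mem hsN hb)) (by
      rw [star_star]
      have := sqrt_conj_mem hP (mul_mem hb (star_mem hb)) (mul_star_self_nonneg b)
      convert this using 1
      rw [star_mul, sP]
      noncomm_ring)
    rwa [star_star] at h
  have h := star_mul_mem_domain hsN (mul_mem hsN hb) hXX hZZ
  rw [sP, ← mul_assoc, hss] at h
  exact ⟨h.1, h.2.trans (ext_of_mem (sqrt_conj_mem hP hb hb0))⟩

theorem mul_mem_domain_of_mem_cone {P B : H →L[ℂ] H} (hP : P ∈ φ.cone) (hB : B ∈ N) :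
    P * B ∈ φ.domain ∧
      φ.ext (P * B) = jordanExtend (fun b => (φ.val (CFC.sqrt P * b * CFC.sqrt P) : ℂ)) B := by
  have h₁ := mul_mem_domain_of_nonneg hP (VonNeumannAlgebra.posPart_mem (realPart_mem hB))
    (CFC.posPart_nonneg _)
  have h₂ := mul_mem_domain_of_nonneg hP (negPart_mem (realPart_mem hB)) (CFC.negPart_nonneg _)
  have h₃ := mul_mem_domain_of_nonneg hP (VonNeumannAlgebra.posPart_mem (imaginaryPart_mem hB))
    (CFC.posPart_nonneg _)
  have h₄ := mul_mem_domain_of_nonneg hP (negPart_mem (imaginaryPart_mem hB))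
    (CFC.negPart_nonneg _)
  have h := jordan_combination_mem_domain h₁.1 h₂.1 h₃.1 h₄.1
  rw [h₁.2, h₂.2, h₃.2, h₄.2] at h
  have e : P * B = (P * (ℜ B : H →L[ℂ] H)⁺ - P * (ℜ B : H →L[ℂ] H)⁻) +
      Complex.I • (P * (ℑ B : H →L[ℂ] H)⁺ - P * (ℑ B : H →L[ℂ] H)⁻) := by
    conv_lhs => rw [← CStarAlgebra.linear_combination_nonneg B]
    rw [mul_add, mul_sub, mul_sub, smul_sub, mul_smul_comm, mul_smul_comm]
  rw [← e] at h
  exact h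

theorem mul_mem_domain {A B : H →L[ℂ] H} (hA : A ∈ φ.domain) (hB : B ∈ N) :
    A * B ∈ φ.domain ∧ φ.ext (A * B) = jordanExtend (fun P => φ.ext (P * B)) A := by
  have h := jordan_combination_mem_domain (mul_mem_domain_of_mem_cone hA.2.1 hB).1
    (mul_mem_domain_of_mem_cone hA.2.2.1 hB).1 (mul_mem_domain_of_mem_cone hA.2.2.2.1 hB).1
    (mul_mem_domain_of_mem_cone hA.2.2.2.2 hB).1
  have e : A * B = ((ℜ A : H →L[ℂ] H)⁺ * B - (ℜ A : H →L[ℂ] H)⁻ * B) +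
      Complex.I • ((ℑ A : H →L[ℂ] H)⁺ * B - (ℑ A : H →L[ℂ] H)⁻ * B) := by
    conv_lhs => rw [← CStarAlgebra.linear_combination_nonneg A]
    rw [add_mul, sub_mul, sub_mul, smul_sub, smul_mul_assoc, smul_mul_assoc]
  rw [← e] at h
  exact h

end TracialFunctional

end TracialFunctional

/-! ### The logarithmic cone: stability and growth of the traces of powers. -/

section LogCone

variable {H : Type*} [NormedAddCommGroup H] [InnerProductSpace ℂ H] [CompleteSpace H]

theorem CFC.smul_rpow {A : Type*} [CStarAlgebra A] [PartialOrder A] [StarOrderedRing A] {a : A}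
    (ha : 0 ≤ a) {c p : ℝ} (hc : 0 ≤ c) (hp : 0 ≤ p) : (c • a) ^ p = c ^ p • a ^ p := by
  have hcp : Continuous fun x : ℝ => x ^ p := Real.continuous_rpow_const hp
  rw [CFC.rpow_eq_cfc_real (smul_nonneg hc ha), CFC.rpow_eq_cfc_real ha,
    ← cfc_comp_smul c (fun x : ℝ => x ^ p) a hcp.continuousOn,
    ← cfc_const_mul (c ^ p) (fun x : ℝ => x ^ p) a hcp.continuousOn]
  refine cfc_congr fun x hx => ?_
  exact Real.mul_rpow hc (spectrum_nonneg_of_nonneg ha hx)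

theorem posPart_sub_algebraMap_eq_cfc {P : H →L[ℂ] H} (hP : IsSelfAdjoint P) (c : ℝ) :
    (P - algebraMap ℝ (H →L[ℂ] H) c)⁺ = cfc (fun x : ℝ => max (x - c) 0) P := by
  have e : P - algebraMap ℝ (H →L[ℂ] H) c = cfc (fun x : ℝ => x - c) P := by
    rw [cfc_sub (fun x : ℝ => x) (fun _ => c) P, cfc_id' .., cfc_const ..]
  have hs : IsSelfAdjoint (cfc (fun x : ℝ => x - c) P) := cfc_predicate _ P
  rw [CFC.posPart_def, cfcₙ_eq_cfc, e, ← cfc_comp' (fun x : ℝ => x⁺) (fun x : ℝ => x - c) P]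
  rfl

namespace FNSTrace

variable {N : VonNeumannAlgebra H} (τ : FNSTrace N)

open VonNeumannAlgebra

theorem map_sum {ι : Type*} (s : Finset ι) {X : ι → H →L[ℂ] H} (hX : ∀ i ∈ s, X i ∈ N)
    (h0 : ∀ i ∈ s, 0 ≤ X i) : τ.toFun (∑ i ∈ s, X i) = ∑ i ∈ s, τ.toFun (X i) := by
  classical
  induction s using Finset.induction_on with
  | empty => simp [τ.map_zero]
  | insert a s ha ih =>
    rw [Finset.sum_insert ha, Finset.sum_insert ha, τ.map_add' _ (hX a (by simp)) _
      (sum_mem fun i hi => hX i (by simp [hi])) (h0 a (by simp))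
      (Finset.sum_nonneg fun i hi => h0 i (by simp [hi])),
      ih (fun i hi => hX i (by simp [hi])) fun i hi => h0 i (by simp [hi])]

/-- The cone of positive operators of `N` whose truncated traces `τ((P - 2⁻ᵏ)₊)` grow at most
linearly in `k`. -/
def logCone : Set (H →L[ℂ] H) :=
  {P | P ∈ N ∧ 0 ≤ P ∧ ∃ C : NNReal, ∀ k : ℕ,
    τ.toFun (P - algebraMap ℝ (H →L[ℂ] H) ((1 / 2) ^ k))⁺ ≤ C * (k + 1)}

variable {τ}

theorem zero_mem_logCone : 0 ∈ τ.logCone := by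
  refine ⟨zero_mem N, le_rfl, 0, fun k => ?_⟩
  have hk : 0 ≤ algebraMap ℝ (H →L[ℂ] H) ((1 / 2) ^ k) := by
    rw [Algebra.algebraMap_eq_smul_one]
    exact smul_nonneg (by positivity) zero_le_one
  rw [zero_sub, (CFC.posPart_eq_zero_iff _ (hk.isSelfAdjoint.neg)).2 (neg_nonpos.2 hk), τ.map_zero]
  exact zero_le

theorem isSelfAdjoint_algebraMap_real (c : ℝ) : IsSelfAdjoint (algebraMap ℝ (H →L[ℂ] H) c) :=
  .algebraMap _ (.all c)

/-- Split the threshold evenly: `P + Q - 2u ≤ (P - u)⁺ + (Q - u)⁺`. With dyadic thresholds, halving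
only moves `k` to `k + 1`, which at most doubles a linear bound. -/
theorem add_mem_logCone {P Q : H →L[ℂ] H} (hP : P ∈ τ.logCone) (hQ : Q ∈ τ.logCone) :
    P + Q ∈ τ.logCone := by
  obtain ⟨hPN, hP0, C, hC⟩ := hP
  obtain ⟨hQN, hQ0, D, hD⟩ := hQ
  refine ⟨add_mem hPN hQN, add_nonneg hP0 hQ0, 2 * (C + D), fun k => ?_⟩
  set u := algebraMap ℝ (H →L[ℂ] H) ((1 / 2) ^ (k + 1)) with hu
  have hsu : IsSelfAdjoint u := isSelfAdjoint_algebraMap_real _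
  have e : algebraMap ℝ (H →L[ℂ] H) ((1 / 2) ^ k) = u + u := by
    rw [hu, ← _root_.map_add]
    congr 1
    ring
  have huN : u ∈ N := algebraMap_real_mem _
  have hle : P + Q - (u + u) ≤ (P - u)⁺ + (Q - u)⁺ := by
    have h1 := CFC.le_posPart (a := P - u) (hP0.isSelfAdjoint.sub hsu)
    have h2 := CFC.le_posPart (a := Q - u) (hQ0.isSelfAdjoint.sub hsu)
    calc P + Q - (u + u) = (P - u) + (Q - u) := by abel
      _ ≤ _ := add_le_add h1 h2
  have hPm : (P - u)⁺ ∈ N := posPart_mem (sub_mem hPN huN)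
  have hQm : (Q - u)⁺ ∈ N := posPart_mem (sub_mem hQN huN)
  rw [e]
  refine (τ.posPart_le (sub_mem (add_mem hPN hQN) (add_mem huN huN)) (add_mem hPm hQm)
    ((hP0.isSelfAdjoint.add hQ0.isSelfAdjoint).sub (hsu.add hsu))
    (add_nonneg (CFC.posPart_nonneg _) (CFC.posPart_nonneg _)) hle).trans ?_
  rw [τ.map_add' _ hPm _ hQm (CFC.posPart_nonneg _) (CFC.posPart_nonneg _)]
  refine (add_le_add (hC (k + 1)) (hD (k + 1))).trans ?_
  have hk : (((k + 1 : ℕ) : ℝ≥0∞) + 1) ≤ 2 * (k + 1) := by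
    norm_cast
    omega
  calc (C : ℝ≥0∞) * (((k + 1 : ℕ) : ℝ≥0∞) + 1) + D * (((k + 1 : ℕ) : ℝ≥0∞) + 1)
      = (C + D) * (((k + 1 : ℕ) : ℝ≥0∞) + 1) := by ring
    _ ≤ (C + D) * (2 * (k + 1)) := by gcongr
    _ = _ := by push_cast; ring

theorem posPart_mem_logCone {P X : H →L[ℂ] H} (hP : P ∈ τ.logCone) (hX : X ∈ N)
    (hXs : IsSelfAdjoint X) (hXP : X ≤ P) : X⁺ ∈ τ.logCone := by
  obtain ⟨hPN, hP0, C, hC⟩ := hP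
  refine ⟨posPart_mem hX, CFC.posPart_nonneg _, C, fun k => ?_⟩
  set u := algebraMap ℝ (H →L[ℂ] H) ((1 / 2) ^ k) with hu
  have hsu : IsSelfAdjoint u := isSelfAdjoint_algebraMap_real _
  have huN : u ∈ N := algebraMap_real_mem _
  have h1 : X⁺ - u ≤ (X - u)⁺ := by
    rw [hu, posPart_sub_algebraMap_eq_cfc hXs, CFC.posPart_def, cfcₙ_eq_cfc,
      ← cfc_const ((1 / 2 : ℝ) ^ k) X, ← cfc_sub (fun x : ℝ => x⁺) (fun _ => (1 / 2 : ℝ) ^ k) X]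
    refine cfc_mono (fun x _ => ?_)
    have h2 : (0 : ℝ) ≤ (1 / 2) ^ k := by positivity
    rw [posPart_def]
    change max x 0 - (1 / 2) ^ k ≤ max (x - (1 / 2) ^ k) 0
    rcases max_cases x 0 with h | h <;> rcases max_cases (x - (1 / 2 : ℝ) ^ k) 0 with h' | h' <;>
      linarith
  have hs : IsSelfAdjoint (X - u) := hXs.sub hsu
  have hN : (X - u)⁺ ∈ N := posPart_mem (sub_mem hX huN)
  refine (τ.posPart_le (sub_mem (posPart_mem hX) huN) hN
    ((CFC.posPart_nonneg X).isSelfAdjoint.sub hsu) (CFC.posPart_nonneg _) h1).trans ?_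
  refine (τ.posPart_le (sub_mem hX huN) (posPart_mem (sub_mem hPN huN)) hs (CFC.posPart_nonneg _)
    ((sub_le_sub_right hXP u).trans (CFC.le_posPart (hP0.isSelfAdjoint.sub hsu)))).trans (hC k)

variable (τ) in
-- Since `c > 0`, the function `(x - c)₊` is `x` times the continuous function `(x - c)₊ / max(x,
-- c)`.
theorem posPart_sub_swap {X : H →L[ℂ] H} (hX : X ∈ N) {c : ℝ} (hc : 0 < c) :
    τ.toFun (star X * X - algebraMap ℝ (H →L[ℂ] H) c)⁺ =
      τ.toFun (X * star X - algebraMap ℝ (H →L[ℂ] H) c)⁺ := by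
  have e : (fun x : ℝ => max (x - c) 0) = fun x => x * (max (x - c) 0 / max x c) := by
    ext x
    rcases le_total x c with h | h
    · simp [max_eq_right (sub_nonpos.2 h)]
    · rw [max_eq_left h, mul_div_cancel₀ _ (hc.trans_le h).ne']
  rw [posPart_sub_algebraMap_eq_cfc (.star_mul_self X),
    posPart_sub_algebraMap_eq_cfc (.mul_star_self X), e]
  refine τ.cfc_star_mul_self hX (Continuous.div (by fun_prop) (by fun_prop) fun x => ?_) fun x => ?_
  · exact (lt_max_of_lt_right hc).ne'
  · have : 0 < max x c := lt_max_of_lt_right hc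
    positivity

theorem swap_mem_logCone {X : H →L[ℂ] H} (hX : X ∈ N) (h : star X * X ∈ τ.logCone) :
    X * star X ∈ τ.logCone := by
  obtain ⟨_, _, C, hC⟩ := h
  refine ⟨mul_mem hX (star_mem hX), mul_star_self_nonneg X, C, fun k => ?_⟩
  rw [← τ.posPart_sub_swap hX (by positivity)]
  exact hC k

variable (τ) in
theorem rpow_swap {X : H →L[ℂ] H} (hX : X ∈ N) {s : ℝ} (hs : 0 < s) :
    τ.toFun ((star X * X) ^ (1 + s)) = τ.toFun ((X * star X) ^ (1 + s)) := by
  have e {a : H →L[ℂ] H} (ha : 0 ≤ a) : a ^ (1 + s) = cfc (fun x : ℝ => x * (max x 0) ^ s) a := by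
    rw [CFC.rpow_eq_cfc_real ha]
    refine cfc_congr fun x hx => ?_
    have hx0 : 0 ≤ x := spectrum_nonneg_of_nonneg ha hx
    change x ^ (1 + s) = x * (max x 0) ^ s
    rw [max_eq_left hx0, Real.rpow_add_of_nonneg hx0 zero_le_one hs.le, Real.rpow_one]
  rw [e (star_mul_self_nonneg X), e (mul_star_self_nonneg X)]
  exact τ.cfc_star_mul_self hX ((Real.continuous_rpow_const hs.le).comp (by fun_prop))
    fun x => by positivity

end FNSTrace

/-- Abel summation in closed form; dropping the remainder bounds the sums uniformly in `K`. -/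
theorem sum_range_one_sub_mul_pow_mul {r : ℝ} (h1 : r < 1) (K : ℕ) :
    ∑ k ∈ Finset.range K, (r ^ k - r ^ (k + 1)) * (k + 2) + r ^ K * (K + 1 + (1 - r)⁻¹) =
      1 + (1 - r)⁻¹ := by
  have hr : 1 - r ≠ 0 := by linarith
  induction K with
  | zero => simp
  | succ K ih =>
    rw [Finset.sum_range_succ, ← ih]
    push_cast
    field_simp
    ring

/-- A dyadic layer-cake bound. Once `2⁻ᵏ ≤ x`, the truncation at `2⁻ᵏ⁻¹` is at least `x/2`, and the
weights telescope from the first such `k`, where `(x/2)^s ≤ r^k`. Subtracting `r^K` allows the sum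
to stop at `K`. -/
theorem mul_rpow_sub_le_sum_posPart {s x : ℝ} (hs : 0 < s) (hx : 0 ≤ x) (hx1 : x ≤ 1) (K : ℕ) :
    x * ((x / 2) ^ s - ((1 / 2 : ℝ) ^ s) ^ K) ≤
      2 * ∑ k ∈ Finset.range K, (((1 / 2 : ℝ) ^ s) ^ k - ((1 / 2 : ℝ) ^ s) ^ (k + 1)) *
        max (x - (1 / 2) ^ (k + 1)) 0 := by
  set r : ℝ := (1 / 2 : ℝ) ^ s with hr
  have r0 : 0 ≤ r := by positivity
  have r1 : r ≤ 1 := Real.rpow_le_one (by norm_num) (by norm_num) hs.le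
  have hdiff (k : ℕ) : 0 ≤ r ^ k - r ^ (k + 1) :=
    sub_nonneg.2 (pow_le_pow_of_le_one r0 r1 (by omega))
  have hsum (K : ℕ) : 0 ≤ 2 * ∑ k ∈ Finset.range K, (r ^ k - r ^ (k + 1)) *
      max (x - (1 / 2) ^ (k + 1)) 0 :=
    mul_nonneg zero_le_two (Finset.sum_nonneg fun k _ => mul_nonneg (hdiff k) (le_max_right _ _))
  induction K with
  | zero =>
    have : (x / 2) ^ s ≤ 1 := Real.rpow_le_one (by positivity) (by linarith) hs.le
    simp only [pow_zero, Finset.range_zero, Finset.sum_empty, mul_zero]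
    nlinarith
  | succ K ih =>
    rcases le_total ((1 / 2 : ℝ) ^ K) x with h | h
    · rw [Finset.sum_range_succ]
      have h1 : x / 2 ≤ max (x - (1 / 2 : ℝ) ^ (K + 1)) 0 := by
        refine le_max_of_le_left ?_
        rw [pow_succ]
        linarith
      nlinarith [mul_le_mul_of_nonneg_left h1 (hdiff K)]
    · refine le_trans ?_ (hsum _)
      have h1 : (x / 2) ^ s ≤ r ^ (K + 1) := by
        rw [hr, ← Real.rpow_natCast, ← Real.rpow_mul (by norm_num), mul_comm s,
          Real.rpow_mul (by norm_num), Real.rpow_natCast]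
        refine Real.rpow_le_rpow (by positivity) ?_ hs.le
        rw [pow_succ]
        linarith
      nlinarith

namespace FNSTrace

variable {N : VonNeumannAlgebra H} {τ : FNSTrace N}

open VonNeumannAlgebra

theorem mem_logCone_of_le {P Q : H →L[ℂ] H} (hP : P ∈ τ.logCone) (hQ : Q ∈ N) (h0 : 0 ≤ Q)
    (h : Q ≤ P) : Q ∈ τ.logCone := by
  have := posPart_mem_logCone hP hQ h0.isSelfAdjoint h
  rwa [(CFC.posPart_eq_self Q).2 h0] at this

theorem trace_cfc_le_sum {Q : H →L[ℂ] H} (hQ : Q ∈ N) (hQ0 : 0 ≤ Q) (hQ1 : Q ≤ 1) {C : NNReal}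
    (hC : ∀ k : ℕ, τ.toFun (Q - algebraMap ℝ (H →L[ℂ] H) ((1 / 2) ^ k))⁺ ≤ C * (k + 1))
    {s : ℝ} (hs : 0 < s) (K : ℕ) :
    τ.toFun (cfc (fun x : ℝ => max (x * ((x / 2) ^ s - ((1 / 2 : ℝ) ^ s) ^ K)) 0) Q) ≤
      ENNReal.ofReal (2 * C * (1 + (1 - (1 / 2 : ℝ) ^ s)⁻¹)) := by
  set r : ℝ := (1 / 2 : ℝ) ^ s with hr
  have r0 : 0 ≤ r := by positivity
  have r1 : r < 1 := Real.rpow_lt_one (by norm_num) (by norm_num) hs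
  have hdiff (k : ℕ) : 0 ≤ r ^ k - r ^ (k + 1) :=
    sub_nonneg.2 (pow_le_pow_of_le_one r0 r1.le (by omega))
  have hcs : Continuous fun x : ℝ => (x / 2) ^ s :=
    (Real.continuous_rpow_const hs.le).comp (by fun_prop)
  have hsQ := hQ0.isSelfAdjoint
  set X : ℕ → H →L[ℂ] H := fun k => (2 * (r ^ k - r ^ (k + 1))) •
    (Q - algebraMap ℝ (H →L[ℂ] H) ((1 / 2) ^ (k + 1)))⁺ with hX
  have hPN (k : ℕ) : (Q - algebraMap ℝ (H →L[ℂ] H) ((1 / 2) ^ (k + 1)))⁺ ∈ N :=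
    posPart_mem (sub_mem hQ (algebraMap_real_mem _))
  have hc0 (k : ℕ) : 0 ≤ 2 * (r ^ k - r ^ (k + 1)) := mul_nonneg zero_le_two (hdiff k)
  have hXN (k : ℕ) : X k ∈ N := real_smul_mem _ (hPN k)
  have hX0 (k : ℕ) : 0 ≤ X k := smul_nonneg (hc0 k) (CFC.posPart_nonneg _)
  have hle : cfc (fun x : ℝ => max (x * ((x / 2) ^ s - r ^ K)) 0) Q ≤
      ∑ k ∈ Finset.range K, X k := by
    have e (k : ℕ) : X k =
        cfc (fun x : ℝ => 2 * (r ^ k - r ^ (k + 1)) * max (x - (1 / 2) ^ (k + 1)) 0) Q := by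
      simp only [hX]
      rw [posPart_sub_algebraMap_eq_cfc hsQ, cfc_const_mul _ _ Q]
    have hcont (k : ℕ) : ContinuousOn
        (fun x : ℝ => 2 * (r ^ k - r ^ (k + 1)) * max (x - (1 / 2) ^ (k + 1)) 0)
        (spectrum ℝ Q) := by fun_prop
    rw [Finset.sum_congr rfl fun k _ => e k,
      ← cfc_sum (fun (k : ℕ) (x : ℝ) => 2 * (r ^ k - r ^ (k + 1)) * max (x - (1 / 2) ^ (k + 1)) 0)
        Q (Finset.range K) fun k _ => hcont k]
    refine cfc_mono (fun x hx => ?_) (by fun_prop) ?_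
    · have hx0 : 0 ≤ x := spectrum_nonneg_of_nonneg hQ0 hx
      have hx1 : x ≤ 1 := (CFC.le_one_iff (R := ℝ) Q).1 hQ1 x hx
      have h := mul_rpow_sub_le_sum_posPart hs hx0 hx1 K
      rw [Finset.mul_sum] at h
      simp only [Finset.sum_apply, mul_assoc]
      refine max_le h (Finset.sum_nonneg fun k _ => ?_)
      exact mul_nonneg zero_le_two (mul_nonneg (hdiff k) (le_max_right _ _))
    · refine ContinuousOn.congr (f := fun x => ∑ k ∈ Finset.range K,
        2 * (r ^ k - r ^ (k + 1)) * max (x - (1 / 2) ^ (k + 1)) 0) (by fun_prop) fun x _ => ?_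
      simp only [Finset.sum_apply]
  refine (τ.mono (cfc_mem hQ _) (sum_mem fun k _ => hXN k)
    (cfc_nonneg fun x _ => le_max_right _ _) hle).trans ?_
  rw [τ.map_sum _ (fun k _ => hXN k) fun k _ => hX0 k]
  calc ∑ k ∈ Finset.range K, τ.toFun (X k)
      ≤ ∑ k ∈ Finset.range K, ENNReal.ofReal (2 * C * ((r ^ k - r ^ (k + 1)) * (k + 2))) := by
        refine Finset.sum_le_sum fun k _ => ?_
        simp only [hX]
        rw [τ.map_smul' _ (hc0 k) _ (hPN k) (CFC.posPart_nonneg _)]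
        have h1 := hC (k + 1)
        have h2 : (C : ℝ≥0∞) * ((k + 1 : ℕ) + 1) = ENNReal.ofReal (C * (k + 2)) := by
          rw [ENNReal.ofReal_mul (by positivity), ENNReal.ofReal_coe_nnreal]
          congr 1
          rw [ENNReal.ofReal_add (by positivity) (by positivity), ENNReal.ofReal_natCast]
          push_cast
          rw [ENNReal.ofReal_ofNat]
          ring
        rw [h2] at h1
        refine (mul_le_mul_right h1 _).trans_eq ?_
        rw [← ENNReal.ofReal_mul (hc0 k)]
        congr 1
        ring
    _ = ENNReal.ofReal (2 * C * ∑ k ∈ Finset.range K, (r ^ k - r ^ (k + 1)) * (k + 2)) := by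
        rw [Finset.mul_sum, ENNReal.ofReal_sum_of_nonneg]
        intro k _
        have := hdiff k
        positivity
    _ ≤ _ := by
        refine ENNReal.ofReal_le_ofReal ?_
        have h := sum_range_one_sub_mul_pow_mul r1 K
        have h2 : 0 ≤ r ^ K * (K + 1 + (1 - r)⁻¹) := by
          have : 0 < 1 - r := by linarith
          positivity
        gcongr
        linarith

/-- Normality lets `K → ∞` in the layer-cake estimate. The growth `1/s` comes from `(1 - 2⁻ˢ)⁻¹`. -/
theorem trace_rpow_le_of_le_one {Q : H →L[ℂ] H} (hQ : Q ∈ N) (hQ0 : 0 ≤ Q) (hQ1 : Q ≤ 1)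
    {C : NNReal}
    (hC : ∀ k : ℕ, τ.toFun (Q - algebraMap ℝ (H →L[ℂ] H) ((1 / 2) ^ k))⁺ ≤ C * (k + 1))
    {s : ℝ} (hs : 0 < s) (hs1 : s ≤ 1) :
    τ.toFun (Q ^ (1 + s)) ≤ ENNReal.ofReal (16 * C / s) := by
  set r : ℝ := (1 / 2 : ℝ) ^ s with hr
  have r0 : 0 < r := by positivity
  have r1 : r < 1 := Real.rpow_lt_one (by norm_num) (by norm_num) hs
  -- Bernoulli's inequality for exponents in `[0, 1]`: `(1 - 1/2)^s ≤ 1 - s/2`.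
  have hrs : s / 2 ≤ 1 - r := by
    have := rpow_one_add_le_one_add_mul_self (s := -(1 / 2)) (by norm_num) hs.le hs1
    norm_num at this
    rw [hr]
    norm_num
    linarith
  have hrh : 1 / 2 ≤ r := by
    have := Real.rpow_le_rpow_of_exponent_ge (x := (1 / 2 : ℝ)) (by norm_num) (by norm_num) hs1
    rwa [Real.rpow_one] at this
  have hcs : Continuous fun x : ℝ => (x / 2) ^ s :=
    (Real.continuous_rpow_const hs.le).comp (by fun_prop)
  have hsQ := hQ0.isSelfAdjoint
  have key : τ.toFun (cfc (fun x : ℝ => x * (x / 2) ^ s) Q) ≤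
      ENNReal.ofReal (2 * C * (1 + (1 - r)⁻¹)) := by
    refine τ.cfc_le_of_tendsto hQ (h := fun K x => max (x * ((x / 2) ^ s - r ^ K)) 0)
      (ε := fun K => r ^ K) (fun K => by fun_prop) (by fun_prop) (fun K x _ => le_max_right _ _)
      ?_ (tendsto_pow_atTop_nhds_zero_of_lt_one r0.le r1) ?_
      fun K => trace_cfc_le_sum hQ hQ0 hQ1 hC hs K
    · intro K x hx
      have hx0 : 0 ≤ x := spectrum_nonneg_of_nonneg hQ0 hx
      refine max_le_max (mul_le_mul_of_nonneg_left (sub_le_sub_left ?_ _) hx0) le_rfl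
      exact pow_le_pow_of_le_one r0.le r1.le (by omega)
    · intro K x hx
      have hx0 : 0 ≤ x := spectrum_nonneg_of_nonneg hQ0 hx
      have hx1 : x ≤ 1 := (CFC.le_one_iff (R := ℝ) Q).1 hQ1 x hx
      have hK : 0 < r ^ K := by positivity
      have hxs : 0 ≤ (x / 2) ^ s := by positivity
      have h1 : x * r ^ K ≤ r ^ K := mul_le_of_le_one_left hK.le hx1
      have h2 : 0 ≤ x * r ^ K := by positivity
      have h3 : 0 ≤ x * (x / 2) ^ s := by positivity
      rw [mul_sub, abs_le]
      rcases max_cases (x * (x / 2) ^ s - x * r ^ K) 0 with h | h <;> constructor <;> linarith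
  have e : Q ^ (1 + s) = (r⁻¹ : ℝ) • cfc (fun x : ℝ => x * (x / 2) ^ s) Q := by
    rw [CFC.rpow_eq_cfc_real hQ0, ← cfc_const_mul _ (fun x : ℝ => x * (x / 2) ^ s) Q (by fun_prop)]
    refine cfc_congr fun x hx => ?_
    have hx0 : 0 ≤ x := spectrum_nonneg_of_nonneg hQ0 hx
    change x ^ (1 + s) = r⁻¹ * (x * (x / 2) ^ s)
    rw [Real.rpow_add_of_nonneg hx0 zero_le_one hs.le, Real.rpow_one, div_eq_mul_one_div x,
      Real.mul_rpow hx0 (by norm_num), ← hr]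
    field_simp
  rw [e, τ.map_smul' _ (by positivity) _ (cfc_mem hQ _) (cfc_nonneg fun x hx => by
    have hx0 : 0 ≤ x := spectrum_nonneg_of_nonneg hQ0 hx
    positivity)]
  refine (mul_le_mul_right key _).trans ?_
  rw [← ENNReal.ofReal_mul (by positivity)]
  refine ENNReal.ofReal_le_ofReal ?_
  have h1 : r⁻¹ ≤ 2 := by
    rw [inv_le_comm₀ r0 two_pos]; linarith
  have h2 : (1 - r)⁻¹ ≤ 2 / s := by
    rw [inv_le_comm₀ (by linarith) (by positivity), inv_div]
    exact hrs
  have h3 : 1 ≤ 2 / s := by rw [le_div_iff₀ hs]; linarith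
  calc r⁻¹ * (2 * C * (1 + (1 - r)⁻¹)) ≤ 2 * (2 * C * (2 / s + 2 / s)) := by
        have : 0 < 1 - r := by linarith
        gcongr
    _ = 16 * C / s := by ring

/-- The traces `τ(P^(1+s))` of an operator of the logarithmic cone grow at most like `1/s`. -/
theorem exists_trace_rpow_le {P : H →L[ℂ] H} (hP : P ∈ τ.logCone) :
    ∃ K : ℝ, 0 ≤ K ∧ ∀ s : ℝ, 0 < s → s ≤ 1 →
      τ.toFun (P ^ (1 + s)) ≤ ENNReal.ofReal (K / s) := by
  have hP0 : 0 ≤ P := hP.2.1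
  obtain ⟨m, hm⟩ := exists_nat_ge ‖P‖
  -- `c ≥ ‖P‖` makes `P/c` a contraction; `c ≥ 1` gives `P/c ≤ P`, so that it stays in the cone by
  -- heredity.
  set c : ℝ := m + 1 with hc
  have hc1 : 1 ≤ c := by rw [hc]; linarith [(Nat.cast_nonneg m : (0 : ℝ) ≤ m)]
  have hc0 : 0 < c := by linarith
  set Q : H →L[ℂ] H := c⁻¹ • P with hQ
  have hQ0 : 0 ≤ Q := smul_nonneg (by positivity) hP0
  have hQN : Q ∈ N := real_smul_mem _ hP.1
  have hQP : Q ≤ P := by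
    have := smul_le_smul_of_nonneg_right (inv_le_one_of_one_le₀ hc1) hP0
    rwa [one_smul] at this
  have hQ1 : Q ≤ 1 := by
    rw [← CStarAlgebra.norm_le_one_iff_of_nonneg Q hQ0, hQ, norm_smul, Real.norm_of_nonneg
      (by positivity), inv_mul_le_iff₀ hc0, mul_one]
    linarith
  obtain ⟨_, _, C, hC⟩ := mem_logCone_of_le hP hQN hQ0 hQP
  refine ⟨c ^ 2 * (16 * C), by positivity, fun s hs hs1 => ?_⟩
  have e : P = c • Q := by rw [hQ, smul_smul, mul_inv_cancel₀ hc0.ne', one_smul]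
  rw [e, CFC.smul_rpow hQ0 hc0.le (by positivity), τ.map_smul' _ (by positivity) _
    (rpow_mem hQN _) CFC.rpow_nonneg]
  refine (mul_le_mul_right (trace_rpow_le_of_le_one hQN hQ0 hQ1 hC hs hs1) _).trans ?_
  rw [← ENNReal.ofReal_mul (by positivity)]
  refine ENNReal.ofReal_le_ofReal ?_
  have h1 : c ^ (1 + s) ≤ c ^ 2 := by
    rw [← Real.rpow_two]
    exact Real.rpow_le_rpow_of_exponent_le hc1 (by linarith)
  calc c ^ (1 + s) * (16 * C / s) ≤ c ^ 2 * (16 * C / s) := by gcongr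
    _ = _ := by ring

/-- Finiteness is also required for `t < 1`, that is `s > 1`; there `P^(1+s) ≤ ‖P‖^(s-1) P²`. -/
theorem trace_rpow_lt_top {P : H →L[ℂ] H} (hP : P ∈ τ.logCone) {s : ℝ} (hs : 0 < s) :
    τ.toFun (P ^ (1 + s)) < ∞ := by
  have hP0 : 0 ≤ P := hP.2.1
  obtain ⟨K, -, hK⟩ := exists_trace_rpow_le hP
  rcases le_total s 1 with h | h
  · exact (hK s hs h).trans_lt ENNReal.ofReal_lt_top
  · have h1 := hK 1 one_pos le_rfl
    have hle : P ^ (1 + s) ≤ (‖P‖ ^ (s - 1)) • P ^ (1 + 1 : ℝ) := by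
      have c1 : Continuous fun x : ℝ => x ^ (1 + s) := Real.continuous_rpow_const (by positivity)
      have c2 : Continuous fun x : ℝ => x ^ (1 + 1 : ℝ) :=
        Real.continuous_rpow_const (by positivity)
      rw [CFC.rpow_eq_cfc_real hP0, CFC.rpow_eq_cfc_real hP0, ← cfc_const_mul _ _ P c2.continuousOn]
      refine cfc_mono (fun x hx => ?_) c1.continuousOn (by fun_prop)
      have hx0 : 0 ≤ x := spectrum_nonneg_of_nonneg hP0 hx
      have hxP : x ≤ ‖P‖ :=
        (le_algebraMap_iff_spectrum_le (a := P)).1 hP0.isSelfAdjoint.le_algebraMap_norm_self x hx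
      have e : 1 + s = (s - 1) + (1 + 1) := by ring
      rw [e, Real.rpow_add_of_nonneg hx0 (by linarith) (by norm_num)]
      gcongr
    refine (τ.mono (rpow_mem hP.1 _) (real_smul_mem _ (rpow_mem hP.1 _)) CFC.rpow_nonneg
      hle).trans_lt ?_
    rw [τ.map_smul' _ (by positivity) _ (rpow_mem hP.1 _) CFC.rpow_nonneg]
    exact ENNReal.mul_lt_top ENNReal.ofReal_lt_top (h1.trans_lt ENNReal.ofReal_lt_top)

end FNSTrace

end LogCone

/-! ### Singular values, and from the Marcinkiewicz space to the logarithmic cone. -/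

section SingularValues

variable {H : Type*} [NormedAddCommGroup H] [InnerProductSpace ℂ H] [CompleteSpace H]

namespace FNSTrace

variable {N : VonNeumannAlgebra H} (τ : FNSTrace N)

open VonNeumannAlgebra

theorem mu_bddBelow (t : ℝ) (A : H →L[ℂ] H) : BddBelow {r : ℝ | ∃ p ∈ N, IsStarProjection p ∧
    τ.toFun (1 - p) ≤ ENNReal.ofReal t ∧ r = ‖A * p‖} :=
  ⟨0, by rintro _ ⟨p, -, -, -, rfl⟩; exact norm_nonneg _⟩

theorem mu_nonempty (t : ℝ) (A : H →L[ℂ] H) : {r : ℝ | ∃ p ∈ N, IsStarProjection p ∧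
    τ.toFun (1 - p) ≤ ENNReal.ofReal t ∧ r = ‖A * p‖}.Nonempty :=
  ⟨‖A * 1‖, 1, one_mem N, .one _, by simp [τ.map_zero], rfl⟩

theorem mu_nonneg (t : ℝ) (A : H →L[ℂ] H) : 0 ≤ τ.mu t A :=
  Real.sInf_nonneg (by rintro _ ⟨p, -, -, -, rfl⟩; exact norm_nonneg _)

theorem mu_antitone (A : H →L[ℂ] H) : Antitone fun t => τ.mu t A := by
  intro s t hst
  refine csInf_le_csInf (τ.mu_bddBelow t A) (τ.mu_nonempty s A) ?_
  rintro _ ⟨p, hp, hpp, h, rfl⟩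
  exact ⟨p, hp, hpp, h.trans (ENNReal.ofReal_le_ofReal hst), rfl⟩

theorem exists_projection_of_mu_lt {t a : ℝ} {A : H →L[ℂ] H} (h : τ.mu t A < a) :
    ∃ p ∈ N, IsStarProjection p ∧ τ.toFun (1 - p) ≤ ENNReal.ofReal t ∧ ‖A * p‖ < a := by
  obtain ⟨_, ⟨p, hp, hpp, ht, rfl⟩, hlt⟩ := exists_lt_of_csInf_lt (τ.mu_nonempty t A) h
  exact ⟨p, hp, hpp, ht, hlt⟩

variable {τ}

/-- For `p` admissible for `A`, pull back along `A*` to get `q` with `A*q = pA*q = (Ap)*q` and no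
larger trace of the complement. -/
theorem mu_star_le (t : ℝ) {A : H →L[ℂ] H} (hA : A ∈ N) : τ.mu t (star A) ≤ τ.mu t A := by
  refine le_csInf (τ.mu_nonempty t A) ?_
  rintro _ ⟨p, hp, hpp, ht, rfl⟩
  obtain ⟨q, hq, hqq, h0, hle⟩ := τ.exists_projection_mul_eq_zero hp hpp (star_mem hA)
  refine (csInf_le (τ.mu_bddBelow t _) ⟨q, hq, hqq, hle.trans ht, rfl⟩).trans ?_
  have e : star A * q = star (A * p) * q := by
    rw [star_mul, hpp.isSelfAdjoint.star_eq]
    rw [sub_mul, sub_mul, one_mul, sub_eq_zero] at h0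
    exact h0
  rw [e]
  calc ‖star (A * p) * q‖ ≤ ‖star (A * p)‖ * ‖q‖ := norm_mul_le _ _
    _ ≤ ‖star (A * p)‖ * 1 := by gcongr; exact hqq.norm_le
    _ = ‖A * p‖ := by rw [mul_one, norm_star]

/-- Pull `p` back along `B`: `Bq = pBq`, so `ABq = (Ap)(Bq)`. -/
theorem mu_mul_le (t : ℝ) (A : H →L[ℂ] H) {B : H →L[ℂ] H} (hB : B ∈ N) :
    τ.mu t (A * B) ≤ ‖B‖ * τ.mu t A := by
  have key : ∀ r ∈ {r : ℝ | ∃ p ∈ N, IsStarProjection p ∧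
      τ.toFun (1 - p) ≤ ENNReal.ofReal t ∧ r = ‖A * p‖}, τ.mu t (A * B) ≤ ‖B‖ * r := by
    rintro _ ⟨p, hp, hpp, ht, rfl⟩
    obtain ⟨q, hq, hqq, h0, hle⟩ := τ.exists_projection_mul_eq_zero hp hpp hB
    refine (csInf_le (τ.mu_bddBelow t _) ⟨q, hq, hqq, hle.trans ht, rfl⟩).trans ?_
    have e : A * B * q = A * p * (B * q) := by
      rw [sub_mul, sub_mul, one_mul, sub_eq_zero] at h0
      calc A * B * q = A * (B * q) := mul_assoc _ _ _
        _ = A * (p * B * q) := by rw [← h0]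
        _ = A * p * (B * q) := by simp only [mul_assoc]
    rw [e, mul_comm ‖B‖]
    refine (norm_mul_le _ _).trans ?_
    gcongr
    calc ‖B * q‖ ≤ ‖B‖ * ‖q‖ := norm_mul_le _ _
      _ ≤ ‖B‖ * 1 := by gcongr; exact hqq.norm_le
      _ = ‖B‖ := mul_one _
  rcases (norm_nonneg B).eq_or_lt with h | h
  · obtain ⟨r, hr⟩ := τ.mu_nonempty t A
    have := key r hr
    rw [← h, zero_mul] at this ⊢
    exact this
  · rw [mul_comm, ← div_le_iff₀ h]
    refine le_csInf (τ.mu_nonempty t A) fun r hr => ?_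
    rw [div_le_iff₀ h, mul_comm]
    exact key r hr

theorem intervalIntegrable_mu (A : H →L[ℂ] H) (a b : ℝ) :
    IntervalIntegrable (fun s => τ.mu s A) MeasureTheory.volume a b :=
  (τ.mu_antitone A).intervalIntegrable

theorem log_one_add_pos {t : ℝ} (ht : 0 < t) : 0 < Real.log (1 + t) := Real.log_pos (by linarith)

theorem mem_M1Infty_of_mu_le {A B : H →L[ℂ] H} (hA : A ∈ τ.M1Infty) (hB : B ∈ N) {c : ℝ}
    (hc : 0 ≤ c) (h : ∀ t, τ.mu t B ≤ c * τ.mu t A) : B ∈ τ.M1Infty := by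
  obtain ⟨-, C, hC⟩ := hA
  refine ⟨hB, c * C, fun t ht => ?_⟩
  have hl := log_one_add_pos ht
  calc 1 / Real.log (1 + t) * ∫ s in (0 : ℝ)..t, τ.mu s B
      ≤ 1 / Real.log (1 + t) * ∫ s in (0 : ℝ)..t, c * τ.mu s A := by
        gcongr
        exact intervalIntegral.integral_mono_on ht.le (intervalIntegrable_mu _ _ _)
          ((intervalIntegrable_mu _ _ _).const_mul c) fun s _ => h s
    _ = c * (1 / Real.log (1 + t) * ∫ s in (0 : ℝ)..t, τ.mu s A) := by
        rw [intervalIntegral.integral_const_mul]; ring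
    _ ≤ c * C := by gcongr; exact hC t ht

theorem star_mem_M1Infty {A : H →L[ℂ] H} (hA : A ∈ τ.M1Infty) : star A ∈ τ.M1Infty :=
  mem_M1Infty_of_mu_le hA (star_mem hA.1) zero_le_one fun t => by
    rw [one_mul]; exact mu_star_le t hA.1

theorem mul_mem_M1Infty {A B : H →L[ℂ] H} (hA : A ∈ τ.M1Infty) (hB : B ∈ N) :
    A * B ∈ τ.M1Infty :=
  mem_M1Infty_of_mu_le hA (mul_mem hA.1 hB) (norm_nonneg B) fun t => mu_mul_le t A hB

/-- Quantifies that the part of `|A|` above `a` is essentially carried by `1 - p`. Let `T` be a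
continuous cutoff of `|A|` from `2a` to `4a` and `G = f(|A|)^{1/2}`, so `GT = G`. Then `TpT ≤ 1/2`
gives `GpG ≤ G²/2`, hence `G² ≤ 2 G(1-p)G`, and the trace of the right side is that of `2
(1-p)G²(1-p) ≤ 2M (1-p)`. The factors `4` and `2` are the price of continuous cutoffs in place of
spectral projections. -/
theorem trace_cfc_abs_le {A p : H →L[ℂ] H} (hA : A ∈ N) (hp : p ∈ N) (hpp : IsStarProjection p)
    {a M : ℝ} (ha : 0 < a) (hAp : ‖A * p‖ ≤ a) {f : ℝ → ℝ} (hf : Continuous f)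
    (hf0 : ∀ x, 0 ≤ f x) (hfa : ∀ x, x ≤ 4 * a → f x = 0) (hM : 0 ≤ M)
    (hfM : ∀ x ∈ spectrum ℝ (CFC.abs A), f x ≤ M) :
    τ.toFun (cfc f (CFC.abs A)) ≤ ENNReal.ofReal (2 * M) * τ.toFun (1 - p) := by
  set P := CFC.abs A with hPdef
  have hP0 : 0 ≤ P := CFC.abs_nonneg A
  have hsP : IsSelfAdjoint P := hP0.isSelfAdjoint
  have hPN : P ∈ N := sqrt_mem (mul_mem (star_mem hA) hA)
  have hpp' : IsStarProjection (1 - p) := hpp.one_sub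
  have hp's : star (1 - p) = 1 - p := hpp'.isSelfAdjoint
  set k : ℝ → ℝ := fun x => min 1 (max 0 ((x - 2 * a) / (2 * a))) with hk
  have ck : Continuous k := by fun_prop
  set g : ℝ → ℝ := fun x => Real.sqrt (f x) with hg
  have cg : Continuous g := by fun_prop
  set T := cfc k P with hT
  set G := cfc g P with hG
  have sT : star T = T := (cfc_predicate k P : IsSelfAdjoint _)
  have sG : star G = G := (cfc_predicate g P : IsSelfAdjoint _)
  have sp : star p = p := hpp.isSelfAdjoint
  have hGN : G ∈ N := cfc_mem hPN _
  have hGG : G * G = cfc f P := by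
    rw [hG, ← cfc_mul g g P cg.continuousOn cg.continuousOn]
    exact cfc_congr fun x _ => Real.mul_self_sqrt (hf0 x)
  have hGT : G * T = G := by
    rw [hG, hT, ← cfc_mul g k P cg.continuousOn ck.continuousOn]
    refine cfc_congr fun x _ => ?_
    rcases le_total x (4 * a) with h | h
    · simp [hg, hfa x h]
    · have : k x = 1 := by
        refine min_eq_left (le_max_of_le_right ?_)
        rw [le_div_iff₀ (by positivity)]
        linarith
      simp [this]
  have hTG : T * G = G := by
    have := congr(star $hGT)
    rwa [star_mul, sT, sG] at this
  have hTT : T * T ≤ ((2 * a) ^ 2)⁻¹ • (star A * A) := by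
    have e : star A * A = cfc (fun x : ℝ => x * x) P := by
      rw [cfc_mul (fun x : ℝ => x) (fun x => x) P, cfc_id' .., hPdef, CFC.abs_mul_abs]
    rw [e, ← cfc_const_mul _ (fun x : ℝ => x * x) P, hT,
      ← cfc_mul k k P ck.continuousOn ck.continuousOn]
    refine cfc_mono (fun x hx => ?_) (by fun_prop) (by fun_prop)
    have hx0 : 0 ≤ x := spectrum_nonneg_of_nonneg hP0 hx
    have hk0 : 0 ≤ k x := le_min zero_le_one (le_max_left _ _)
    have hkx : k x ≤ x / (2 * a) := by
      rcases le_total x (2 * a) with h | h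
      · have : k x ≤ 0 := by
          refine (min_le_right _ _).trans (max_le le_rfl ?_)
          exact div_nonpos_of_nonpos_of_nonneg (by linarith) (by positivity)
        exact this.trans (by positivity)
      · refine (min_le_left _ _).trans ?_
        rw [le_div_iff₀ (by positivity)]
        linarith
    calc k x * k x ≤ x / (2 * a) * (x / (2 * a)) := mul_le_mul hkx hkx hk0 (by positivity)
      _ = _ := by field_simp
  -- The C*-identity replaces `TpT` by `pT²p`, and `T² ≤ |A|²/(2a)²` bounds that by `‖Ap‖²/(2a)² ≤
  -- 1/4`.
  have hnorm : ‖T * p * T‖ ≤ 1 / 2 := by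
    have e1 : T * p * T = star (p * T) * (p * T) := by
      rw [star_mul, sT, sp]
      calc T * p * T = T * (p * p) * T := by rw [hpp.isIdempotentElem.eq]
        _ = _ := by noncomm_ring
    have e2 : p * T * star (p * T) = p * (T * T) * p := by
      rw [star_mul, sT, sp]; noncomm_ring
    rw [e1, CStarRing.norm_star_mul_self, ← CStarRing.norm_self_mul_star, e2]
    have h1 := star_left_conjugate_le_conjugate hTT p
    rw [sp] at h1
    have h0 : 0 ≤ p * (T * T) * p := by rw [← e2]; exact mul_star_self_nonneg _
    refine (CStarAlgebra.norm_le_norm_of_nonneg_of_le h0 h1).trans ?_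
    have e3 : p * ((2 * a) ^ 2)⁻¹ • (star A * A) * p =
        ((2 * a) ^ 2)⁻¹ • (star (A * p) * (A * p)) := by
      rw [star_mul, sp, mul_smul_comm, smul_mul_assoc]
      congr 1
    rw [e3, norm_smul, CStarRing.norm_star_mul_self, Real.norm_of_nonneg (by positivity)]
    have h2 : ‖A * p‖ * ‖A * p‖ ≤ a * a := mul_le_mul hAp hAp (norm_nonneg _) ha.le
    calc ((2 * a) ^ 2)⁻¹ * (‖A * p‖ * ‖A * p‖) ≤ ((2 * a) ^ 2)⁻¹ * (a * a) := by gcongr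
      _ ≤ 1 / 2 := by field_simp; norm_num
  have hTpT : T * p * T ≤ algebraMap ℝ (H →L[ℂ] H) (1 / 2) := by
    have h0 : 0 ≤ T * p * T := by
      have := star_left_conjugate_nonneg hpp.nonneg T
      rwa [sT] at this
    exact (CStarAlgebra.norm_le_iff_le_algebraMap _ (by norm_num) h0).1 hnorm
  have hGpG : G * p * G ≤ (1 / 2 : ℝ) • (G * G) := by
    have := star_left_conjugate_le_conjugate hTpT G
    rw [sG] at this
    calc G * p * G = G * T * p * (T * G) := by rw [hGT, hTG]
      _ = G * (T * p * T) * G := by noncomm_ring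
      _ ≤ _ := this
      _ = _ := by rw [Algebra.algebraMap_eq_smul_one, mul_smul_comm, smul_mul_assoc, mul_one]
  have hmain : G * G ≤ (2 : ℝ) • (G * (1 - p) * G) := by
    have e : (2 : ℝ) • (G * (1 - p) * G) - G * G =
        (2 : ℝ) • ((1 / 2 : ℝ) • (G * G) - G * p * G) := by
      rw [mul_sub, mul_one, sub_mul]
      module
    rw [← sub_nonneg, e]
    exact smul_nonneg zero_le_two (sub_nonneg.2 hGpG)
  have h1pN : 1 - p ∈ N := sub_mem (one_mem N) hp
  have hGpGN : G * (1 - p) * G ∈ N := mul_mem (mul_mem hGN h1pN) hGN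
  have hGpG0 : 0 ≤ G * (1 - p) * G := by
    have := star_left_conjugate_nonneg hpp'.nonneg G
    rwa [sG] at this
  rw [← hGG]
  refine (τ.mono (mul_mem hGN hGN) (real_smul_mem _ hGpGN)
    (by nth_rw 1 [← sG]; exact star_mul_self_nonneg G) hmain).trans ?_
  rw [τ.map_smul' _ zero_le_two _ hGpGN hGpG0, ENNReal.ofReal_mul zero_le_two,
    mul_assoc (ENNReal.ofReal 2)]
  refine mul_le_mul_right ?_ _
  have t := τ.tracial' ((1 - p) * G) (mul_mem h1pN hGN)
  have e1 : star ((1 - p) * G) * ((1 - p) * G) = G * (1 - p) * G := by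
    rw [star_mul, sG, hp's]
    calc G * (1 - p) * ((1 - p) * G) = G * ((1 - p) * (1 - p)) * G := by noncomm_ring
      _ = _ := by rw [hpp'.isIdempotentElem.eq]
  have e2 : (1 - p) * G * star ((1 - p) * G) = (1 - p) * (G * G) * (1 - p) := by
    rw [star_mul, sG, hp's]; noncomm_ring
  rw [e1, e2] at t
  rw [t, ← τ.map_smul' M hM _ h1pN hpp'.nonneg]
  refine τ.mono (mul_mem (mul_mem h1pN (mul_mem hGN hGN)) h1pN) (real_smul_mem _ h1pN)
    (by rw [← e2]; exact mul_star_self_nonneg _) ?_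
  have hGM : G * G ≤ algebraMap ℝ (H →L[ℂ] H) M := by
    rw [hGG]
    exact cfc_le_algebraMap f M P hfM
  have := star_left_conjugate_le_conjugate hGM (1 - p)
  rw [hp's] at this
  refine this.trans_eq ?_
  rw [Algebra.algebraMap_eq_smul_one, mul_smul_comm, smul_mul_assoc, mul_one,
    hpp'.isIdempotentElem.eq]

/-- `μ` decreases, so each term with `k ≥ 1` is at most twice the integral over `[2ᵏ⁻¹, 2ᵏ]`; the
term `k = 0` uses `[0, 1]`. -/
theorem sum_two_pow_mul_mu_le (A : H →L[ℂ] H) (K : ℕ) :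
    ∑ k ∈ Finset.range (K + 1), 2 ^ k * τ.mu (2 ^ k) A ≤
      2 * ∫ s in (0 : ℝ)..2 ^ K, τ.mu s A := by
  have hstep (a b : ℝ) (hab : a ≤ b) : (b - a) * τ.mu b A ≤ ∫ s in a..b, τ.mu s A := by
    have := intervalIntegral.integral_mono_on hab (intervalIntegrable_const (c := τ.mu b A))
      (intervalIntegrable_mu A a b) fun s hs => τ.mu_antitone A hs.2
    simpa using this
  induction K with
  | zero =>
    have h := hstep 0 1 zero_le_one
    have := τ.mu_nonneg 1 A
    simp only [zero_add, Finset.range_one, Finset.sum_singleton, pow_zero, one_mul] at h ⊢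
    linarith
  | succ K ih =>
    have h := hstep (2 ^ K) (2 ^ (K + 1)) (by gcongr <;> norm_num)
    rw [Finset.sum_range_succ, ← intervalIntegral.integral_add_adjacent_intervals
      (intervalIntegrable_mu A 0 (2 ^ K)) (intervalIntegrable_mu A _ (2 ^ (K + 1)))]
    have e : ((2 : ℝ) ^ (K + 1) - 2 ^ K) = 2 ^ K := by ring
    rw [e] at h
    have e2 : (2 : ℝ) ^ (K + 1) * τ.mu (2 ^ (K + 1)) A = 2 * (2 ^ K * τ.mu (2 ^ (K + 1)) A) := by
      generalize τ.mu (2 ^ (K + 1)) A = m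
      ring
    rw [e2]
    linarith

/-- Cut at the levels `c_k = 4 μ(2ᵏ) + δ`. The slice between `c_{k+1}` and `c_k` has height at most
`4 μ(2ᵏ)` and trace at most `2 · 4 μ(2ᵏ) · 2ᵏ⁺¹`. The margin `δ` is there because the infimum
defining `μ` need not be attained. -/
theorem trace_cfc_truncation_le {A : H →L[ℂ] H} (hA : A ∈ N) {δ : ℝ} (hδ : 0 < δ) (K : ℕ) :
    τ.toFun (cfc (fun x : ℝ => max (x - (4 * τ.mu (2 ^ K) A + δ)) 0) (CFC.abs A)) ≤
      ENNReal.ofReal (2 * ‖A‖ + 16 * ∑ k ∈ Finset.range K, 2 ^ k * τ.mu (2 ^ k) A) := by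
  have hP0 : 0 ≤ CFC.abs A := CFC.abs_nonneg A
  have hPN : CFC.abs A ∈ N := sqrt_mem (mul_mem (star_mem hA) hA)
  have hmu (k : ℕ) : 0 ≤ τ.mu (2 ^ k) A := τ.mu_nonneg _ _
  have hproj (k : ℕ) : ∃ p ∈ N, IsStarProjection p ∧ τ.toFun (1 - p) ≤ ENNReal.ofReal (2 ^ k) ∧
      ‖A * p‖ < τ.mu (2 ^ k) A + δ / 4 :=
    τ.exists_projection_of_mu_lt (by linarith)
  induction K with
  | zero =>
    obtain ⟨p, hp, hpp, ht, hlt⟩ := hproj 0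
    have hm := hmu 0
    generalize τ.mu (2 ^ 0) A = m at hm hlt ⊢
    have h := trace_cfc_abs_le (τ := τ) hA hp hpp (a := m + δ / 4) (M := ‖A‖)
      (by linarith) hlt.le
      (f := fun x : ℝ => max (x - (4 * m + δ)) 0) (by fun_prop)
      (fun x => le_max_right _ _) (fun x hx => max_eq_right (by linarith)) (norm_nonneg A) ?_
    · refine h.trans ?_
      rw [Finset.range_zero, Finset.sum_empty, mul_zero, add_zero]
      refine (mul_le_mul_right ht _).trans ?_
      simp
    · intro x hx
      have hxA : x ≤ ‖CFC.abs A‖ :=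
        (le_algebraMap_iff_spectrum_le (a := CFC.abs A)).1
          hP0.isSelfAdjoint.le_algebraMap_norm_self x hx
      rw [CFC.norm_abs] at hxA
      exact max_le (by linarith) (norm_nonneg A)
  | succ K ih =>
    obtain ⟨p, hp, hpp, ht, hlt⟩ := hproj (K + 1)
    set b := 4 * τ.mu (2 ^ K) A + δ with hb
    set c := 4 * τ.mu (2 ^ (K + 1)) A + δ with hc
    have hcb : c ≤ b := by
      have := τ.mu_antitone A (show (2 : ℝ) ^ K ≤ 2 ^ (K + 1) by gcongr <;> norm_num)
      simp only at this
      linarith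
    have hu0 (x : ℝ) : 0 ≤ max (x - c) 0 - max (x - b) 0 :=
      sub_nonneg.2 (max_le_max (by linarith) le_rfl)
    have h := trace_cfc_abs_le (τ := τ) hA hp hpp (a := τ.mu (2 ^ (K + 1)) A + δ / 4) (M := b - c)
      (by linarith [hmu (K + 1)]) hlt.le
      (f := fun x : ℝ => max (x - c) 0 - max (x - b) 0) (by fun_prop) hu0 ?_ (by linarith) ?_
    · have e : cfc (fun x : ℝ => max (x - c) 0) (CFC.abs A) =
          cfc (fun x : ℝ => max (x - b) 0) (CFC.abs A) +
            cfc (fun x : ℝ => max (x - c) 0 - max (x - b) 0) (CFC.abs A) := by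
        rw [← cfc_add (a := CFC.abs A) (fun x : ℝ => max (x - b) 0)
          (fun x : ℝ => max (x - c) 0 - max (x - b) 0)]
        congr 1
        ext x
        ring
      rw [e, τ.map_add' _ (cfc_mem hPN _) _ (cfc_mem hPN _)
        (cfc_nonneg fun x _ => le_max_right _ _) (cfc_nonneg fun x _ => hu0 x)]
      refine (add_le_add ih (h.trans (mul_le_mul_right ht _))).trans ?_
      have hsum : 0 ≤ ∑ k ∈ Finset.range K, 2 ^ k * τ.mu (2 ^ k) A :=
        Finset.sum_nonneg fun k _ => mul_nonneg (by positivity) (hmu k)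
      rw [← ENNReal.ofReal_mul (by linarith), ← ENNReal.ofReal_add (by positivity)
        (mul_nonneg (by linarith) (by positivity)), Finset.sum_range_succ]
      refine ENNReal.ofReal_le_ofReal ?_
      have h1 : b - c ≤ 4 * τ.mu (2 ^ K) A := by linarith [hmu (K + 1)]
      have h2 : 2 * (b - c) * 2 ^ (K + 1) ≤ 2 * (4 * τ.mu (2 ^ K) A) * 2 ^ (K + 1) := by gcongr
      have e2 : (2 : ℝ) ^ (K + 1) = 2 * 2 ^ K := by ring
      rw [e2] at h2 ⊢
      linarith
    · intro x hx
      rw [max_eq_right (by linarith), max_eq_right (by linarith), sub_zero]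
    · intro x _
      rcases max_cases (x - c) 0 with h | h <;> rcases max_cases (x - b) 0 with h' | h' <;> linarith

/-- The absolute value of an operator of the Marcinkiewicz space lies in the logarithmic cone. -/
theorem abs_mem_logCone {A : H →L[ℂ] H} (hA : A ∈ τ.M1Infty) : CFC.abs A ∈ τ.logCone := by
  obtain ⟨hAN, C₀, hC₀⟩ := hA
  have hP0 : 0 ≤ CFC.abs A := CFC.abs_nonneg A
  have hPN : CFC.abs A ∈ N := sqrt_mem (mul_mem (star_mem hAN) hAN)
  set C := max C₀ 0 with hCdef
  have hC0 : 0 ≤ C := le_max_right _ _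
  have hI (t : ℝ) (ht : 0 < t) : ∫ s in (0 : ℝ)..t, τ.mu s A ≤ C * Real.log (1 + t) := by
    have := (hC₀ t ht).trans (le_max_left C₀ 0)
    rwa [one_div, inv_mul_le_iff₀ (log_one_add_pos ht), mul_comm] at this
  -- With `j = k + n`, the crude bound `log(1 + 4ʲ) ≤ 2 · 2ʲ` gives `4 μ(4ʲ) ≤ 8C/2ʲ`. The choice
  -- `16C < 2ⁿ` puts this below `2⁻ᵏ/2`, leaving the other half for `δ`.
  obtain ⟨n, hn⟩ := pow_unbounded_of_one_lt (16 * C) (one_lt_two : (1 : ℝ) < 2)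
  refine ⟨hPN, hP0, Real.toNNReal (2 * ‖A‖ + 64 * C * (n + 1)), fun k => ?_⟩
  set j := k + n with hj
  have h4 : (2 : ℝ) ^ (2 * j) = 4 ^ j := by rw [pow_mul]; norm_num
  have hmuj : τ.mu (2 ^ (2 * j)) A ≤ 2 * C / 2 ^ j := by
    have h1 : (2 : ℝ) ^ (2 * j) * τ.mu (2 ^ (2 * j)) A ≤
        ∫ s in (0 : ℝ)..2 ^ (2 * j), τ.mu s A := by
      have := intervalIntegral.integral_mono_on (a := 0) (b := 2 ^ (2 * j)) (by positivity)
        (intervalIntegrable_const (c := τ.mu (2 ^ (2 * j)) A))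
        (intervalIntegrable_mu A 0 (2 ^ (2 * j))) fun s hs => τ.mu_antitone A hs.2
      simpa using this
    have h2 := h1.trans (hI _ (by positivity))
    have h3 : Real.log (1 + 2 ^ (2 * j)) ≤ 2 * 2 ^ j := by
      calc Real.log (1 + 2 ^ (2 * j)) ≤ Real.log ((1 + 2 ^ j) ^ 2) := by
            refine Real.log_le_log (by positivity) ?_
            have : (2 : ℝ) ^ (2 * j) = (2 ^ j) ^ 2 := by rw [← pow_mul, mul_comm]
            rw [this]
            nlinarith [show (0 : ℝ) < 2 ^ j by positivity]
        _ = 2 * Real.log (1 + 2 ^ j) := by rw [Real.log_pow]; norm_num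
        _ ≤ 2 * 2 ^ j := by
            have := Real.log_le_sub_one_of_pos (show (0 : ℝ) < 1 + 2 ^ j by positivity)
            linarith
    have h5 : (2 : ℝ) ^ (2 * j) = 2 ^ j * 2 ^ j := by rw [← pow_add, two_mul]
    rw [le_div_iff₀ (by positivity)]
    have h6 : (0 : ℝ) < 2 ^ j := by positivity
    have h7 : 2 ^ j * (τ.mu (2 ^ (2 * j)) A * 2 ^ j) ≤ 2 ^ j * (2 * C) := by
      calc 2 ^ j * (τ.mu (2 ^ (2 * j)) A * 2 ^ j) = 2 ^ (2 * j) * τ.mu (2 ^ (2 * j)) A := by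
            conv_rhs => rw [h5]
            ring_nf
        _ ≤ C * Real.log (1 + 2 ^ (2 * j)) := h2
        _ ≤ C * (2 * 2 ^ j) := by gcongr
        _ = _ := by ring
    exact le_of_mul_le_mul_left h7 h6
  have hδ : (0 : ℝ) < (1 / 2) ^ k / 2 := by positivity
  have hle : 4 * τ.mu (2 ^ (2 * j)) A + (1 / 2) ^ k / 2 ≤ (1 / 2) ^ k := by
    have h1 : 4 * (2 * C / 2 ^ j) ≤ (1 / 2) ^ k / 2 := by
      rw [hj, pow_add, one_div, inv_pow]
      have h2 : (0 : ℝ) < 2 ^ k := by positivity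
      have h3 : (0 : ℝ) < 2 ^ n := by positivity
      field_simp
      linarith
    linarith
  have htr := trace_cfc_truncation_le (τ := τ) hAN hδ (2 * j)
  rw [posPart_sub_algebraMap_eq_cfc hP0.isSelfAdjoint]
  refine (τ.mono (cfc_mem hPN _) (cfc_mem hPN _) (cfc_nonneg fun x _ => le_max_right _ _)
    (cfc_mono (fun x _ => max_le_max (sub_le_sub_left hle x) le_rfl) (by fun_prop)
      (by fun_prop))).trans (htr.trans ?_)
  -- Here the logarithm is bounded sharply, by a multiple of `j`: this produces the linear growth in
  -- `k`.
  have hsum : ∑ i ∈ Finset.range (2 * j), 2 ^ i * τ.mu (2 ^ i) A ≤ 2 * (C * (2 * (j + 1))) := by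
    have h1 : ∑ i ∈ Finset.range (2 * j), 2 ^ i * τ.mu (2 ^ i) A ≤
        ∑ i ∈ Finset.range (2 * j + 1), 2 ^ i * τ.mu (2 ^ i) A := by
      rw [Finset.sum_range_succ]
      have := τ.mu_nonneg (2 ^ (2 * j)) A
      have : 0 ≤ 2 ^ (2 * j) * τ.mu (2 ^ (2 * j)) A := by positivity
      linarith
    refine h1.trans ((sum_two_pow_mul_mu_le A (2 * j)).trans ?_)
    have h2 : Real.log (1 + 2 ^ (2 * j)) ≤ 2 * (j + 1) := by
      calc Real.log (1 + 2 ^ (2 * j)) ≤ Real.log (2 ^ (2 * j + 1)) := by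
            refine Real.log_le_log (by positivity) ?_
            have : (1 : ℝ) ≤ 2 ^ (2 * j) := one_le_pow₀ one_le_two
            rw [pow_succ]
            linarith
        _ = (2 * j + 1 : ℕ) * Real.log 2 := Real.log_pow _ _
        _ ≤ (2 * j + 1 : ℕ) * 1 := by
            gcongr
            linarith [Real.log_two_lt_d9]
        _ ≤ _ := by push_cast; linarith
    have h3 := hI (2 ^ (2 * j)) (by positivity)
    have h4 : C * Real.log (1 + 2 ^ (2 * j)) ≤ C * (2 * (j + 1)) := by gcongr
    linarith
  have hfin : 2 * ‖A‖ + 16 * ∑ i ∈ Finset.range (2 * j), 2 ^ i * τ.mu (2 ^ i) A ≤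
      (2 * ‖A‖ + 64 * C * (n + 1)) * (k + 1) := by
    have hk0 : (0 : ℝ) ≤ k := Nat.cast_nonneg k
    have hn0 : (0 : ℝ) ≤ n := Nat.cast_nonneg n
    have hA0 := norm_nonneg A
    have e : (j : ℝ) = k + n := by rw [hj]; push_cast; ring
    rw [e] at hsum
    nlinarith [mul_nonneg hA0 hk0, mul_nonneg (mul_nonneg hC0 hn0) hk0]
  refine (ENNReal.ofReal_le_ofReal hfin).trans_eq ?_
  rw [ENNReal.ofReal_mul (by positivity), ENNReal.ofReal_add (by positivity) zero_le_one,
    ENNReal.ofReal_natCast, ENNReal.ofReal_one]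
  rfl

end FNSTrace

end SingularValues

/-! ### Calculus of generalised limits. -/

section GeneralisedLimits

theorem tailPart_add (x y : Set.Ioi (0 : ℝ) → ℝ) :
    tailPart (fun t => x t + y t) = tailPart x + tailPart y :=
  Set.indicator_add _ x y

theorem tailPart_const_mul (c : ℝ) (x : Set.Ioi (0 : ℝ) → ℝ) :
    tailPart (fun t => c * x t) = c • tailPart x :=
  Set.indicator_const_smul _ c x

theorem tailPart_add_mem {x y : Set.Ioi (0 : ℝ) → ℝ} (hx : tailPart x ∈ LInfty)
    (hy : tailPart y ∈ LInfty) : tailPart (fun t => x t + y t) ∈ LInfty := by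
  rw [tailPart_add]
  exact add_mem hx hy

theorem tailPart_const_mul_mem (c : ℝ) {x : Set.Ioi (0 : ℝ) → ℝ} (hx : tailPart x ∈ LInfty) :
    tailPart (fun t => c * x t) ∈ LInfty := by
  rw [tailPart_const_mul]
  exact LInfty.smul_mem c hx

theorem tailPart_sub_mem {x y : Set.Ioi (0 : ℝ) → ℝ} (hx : tailPart x ∈ LInfty)
    (hy : tailPart y ∈ LInfty) : tailPart (fun t => x t - y t) ∈ LInfty := by
  simpa only [neg_one_mul, ← sub_eq_add_neg] using
    tailPart_add_mem hx (tailPart_const_mul_mem (-1) hy)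

namespace GeneralisedLimit

variable (γ : GeneralisedLimit)

theorem eval_add {x y : Set.Ioi (0 : ℝ) → ℝ} (hx : tailPart x ∈ LInfty)
    (hy : tailPart y ∈ LInfty) : γ.eval (fun t => x t + y t) = γ.eval x + γ.eval y := by
  unfold eval
  rw [dif_pos hx, dif_pos hy, dif_pos (tailPart_add_mem hx hy), ← map_add]
  congr 1
  exact Subtype.ext (tailPart_add x y)

theorem eval_const_mul (c : ℝ) {x : Set.Ioi (0 : ℝ) → ℝ} (hx : tailPart x ∈ LInfty) :
    γ.eval (fun t => c * x t) = c * γ.eval x := by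
  unfold eval
  rw [dif_pos hx, dif_pos (tailPart_const_mul_mem c hx), ← smul_eq_mul, ← map_smul]
  congr 1
  exact Subtype.ext (tailPart_const_mul c x)

theorem eval_sub {x y : Set.Ioi (0 : ℝ) → ℝ} (hx : tailPart x ∈ LInfty)
    (hy : tailPart y ∈ LInfty) : γ.eval (fun t => x t - y t) = γ.eval x - γ.eval y := by
  have h := γ.eval_add hx (tailPart_const_mul_mem (-1) hy)
  rw [γ.eval_const_mul (-1) hy] at h
  simpa only [neg_one_mul, ← sub_eq_add_neg] using h

/-- The positive part of `x - y` tends to `0`, so `γ` annihilates it, and adding it to `y` dominates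
`x`. -/
theorem eval_le_of_le_add {x y : Set.Ioi (0 : ℝ) → ℝ} (hx : tailPart x ∈ LInfty)
    (hy : tailPart y ∈ LInfty)
    (h : ∀ ε : ℝ, 0 < ε → ∃ T : ℝ, ∀ t : Set.Ioi (0 : ℝ), T ≤ t → x t ≤ y t + ε) :
    γ.eval x ≤ γ.eval y := by
  have hd : tailPart x - tailPart y ∈ LInfty := sub_mem hx hy
  obtain ⟨hm, C, hC⟩ := hd
  set w : Set.Ioi (0 : ℝ) → ℝ := fun t => max ((tailPart x - tailPart y) t) 0 with hw
  have hwm : w ∈ LInfty := by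
    refine ⟨hm.max aemeasurable_const, C, fun t => ?_⟩
    have := hC t
    rw [abs_of_nonneg (le_max_right _ _)]
    exact max_le ((le_abs_self _).trans this) ((abs_nonneg _).trans this)
  have h0 : γ.toLinearMap ⟨w, hwm⟩ = 0 := by
    refine γ.vanish' _ fun ε hε => ?_
    obtain ⟨T, hT⟩ := h ε hε
    refine ⟨max T 1, fun t ht => ?_⟩
    have h1 : (1 : ℝ) ≤ t := (le_max_right _ _).trans ht
    have h2 := hT t ((le_max_left _ _).trans ht)
    change |max (tailPart x t - tailPart y t) 0| ≤ ε
    rw [abs_of_nonneg (le_max_right _ _)]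
    refine max_le ?_ hε.le
    rw [tailPart, tailPart, Set.indicator_of_mem (by exact h1), Set.indicator_of_mem (by exact h1)]
    linarith
  have h1 := γ.nonneg' (⟨tailPart y, hy⟩ + ⟨w, hwm⟩ - ⟨tailPart x, hx⟩) fun t => by
    have : tailPart x t - tailPart y t ≤ w t := le_max_left _ _
    change 0 ≤ tailPart y t + w t - tailPart x t
    linarith
  rw [map_sub, map_add, h0] at h1
  unfold eval
  rw [dif_pos hx, dif_pos hy]
  linarith

theorem eval_mono {x y : Set.Ioi (0 : ℝ) → ℝ} (hx : tailPart x ∈ LInfty)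
    (hy : tailPart y ∈ LInfty) (h : ∀ t : Set.Ioi (0 : ℝ), (1 : ℝ) ≤ t → x t ≤ y t) :
    γ.eval x ≤ γ.eval y :=
  γ.eval_le_of_le_add hx hy fun ε hε => ⟨1, fun t ht => by linarith [h t ht]⟩

/-- `c^(1/t) → 1` and `y` is bounded, so the factor costs nothing in the limit. -/
theorem eval_le_of_le_rpow_mul {x y : Set.Ioi (0 : ℝ) → ℝ} (hx : tailPart x ∈ LInfty)
    (hy : tailPart y ∈ LInfty) {c : ℝ} (hc : 0 < c)
    (h : ∀ t : Set.Ioi (0 : ℝ), (1 : ℝ) < t → x t ≤ c ^ (1 / (t : ℝ)) * y t) :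
    γ.eval x ≤ γ.eval y := by
  refine γ.eval_le_of_le_add hx hy fun ε hε => ?_
  obtain ⟨-, C, hC⟩ := hy
  have hl : Filter.Tendsto (fun t : ℝ => |c ^ (1 / t) - 1| * C) Filter.atTop (nhds 0) := by
    have h1 : Filter.Tendsto (fun t : ℝ => 1 / t) Filter.atTop (nhds 0) := by
      simpa only [one_div] using tendsto_inv_atTop_zero
    have h2 : Filter.Tendsto (fun t : ℝ => c ^ (1 / t)) Filter.atTop (nhds (c ^ (0 : ℝ))) :=
      ((Real.continuousAt_const_rpow hc.ne').tendsto).comp h1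
    have h3 := ((h2.sub_const 1).abs).mul_const C
    simpa using h3
  obtain ⟨T, hT⟩ := Filter.eventually_atTop.1 (hl.eventually_le_const hε)
  refine ⟨max T 2, fun t ht => ?_⟩
  have h1 : (1 : ℝ) < t := one_lt_two.trans_le ((le_max_right _ _).trans ht)
  have h2 := hT t ((le_max_left _ _).trans ht)
  have h3 := h t h1
  have h4 := hC t
  rw [tailPart, Set.indicator_of_mem (by exact h1.le)] at h4
  have h5 : (c ^ (1 / (t : ℝ)) - 1) * y t ≤ |c ^ (1 / (t : ℝ)) - 1| * C := by
    refine (le_abs_self _).trans ?_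
    rw [abs_mul]
    gcongr
  linarith

end GeneralisedLimit

end GeneralisedLimits

/-! ### The zeta functional as a tracial functional, and the core identity. -/

section Zeta

variable {H : Type*} [NormedAddCommGroup H] [InnerProductSpace ℂ H] [CompleteSpace H]

namespace FNSTrace

variable {N : VonNeumannAlgebra H} {τ : FNSTrace N}

open VonNeumannAlgebra

theorem posPart_realPart_mem_logCone {A : H →L[ℂ] H} (hA : A ∈ N)
    (h₁ : CFC.abs A ∈ τ.logCone) (h₂ : CFC.abs (star A) ∈ τ.logCone) :
    (ℜ A : H →L[ℂ] H)⁺ ∈ τ.logCone := by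
  have hP := add_mem_logCone h₁ h₂
  refine posPart_mem_logCone hP (realPart_mem hA) (ℜ A).2 ?_
  have h := add_star_le_abs_add_abs_star A
  rw [realPart_apply_coe]
  calc (2⁻¹ : ℝ) • (A + star A) ≤ (2⁻¹ : ℝ) • (CFC.abs A + CFC.abs (star A)) :=
        smul_le_smul_of_nonneg_left h (by norm_num)
    _ ≤ (1 : ℝ) • (CFC.abs A + CFC.abs (star A)) :=
        smul_le_smul_of_nonneg_right (by norm_num) hP.2.1
    _ = _ := one_smul _ _

/-- The four Jordan parts are the positive parts of `ℜ(cA)` for `c = 1, -1, -i, i`, and rotating `A`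
changes neither `|A|` nor `|A*|`. -/
theorem jordanForall_mem_logCone {A : H →L[ℂ] H} (hA : A ∈ τ.M1Infty) :
    JordanForall (· ∈ τ.logCone) A := by
  have h₁ := abs_mem_logCone hA
  have h₂ := abs_mem_logCone (star_mem_M1Infty hA)
  have key (c : ℂ) (hc : ‖c‖ = 1) : (ℜ (c • A) : H →L[ℂ] H)⁺ ∈ τ.logCone := by
    refine posPart_realPart_mem_logCone (complex_smul_mem c hA.1) ?_ ?_
    · rwa [CFC.abs_smul, hc, one_smul]
    · rwa [star_smul, CFC.abs_smul, norm_star, hc, one_smul]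
  refine ⟨?_, ?_, ?_, ?_⟩
  · have h := key 1 norm_one
    rwa [one_smul] at h
  · have h := key (-1) (by rw [norm_neg, norm_one])
    rwa [neg_smul, one_smul, _root_.map_neg, NegMemClass.coe_neg, CFC.posPart_neg] at h
  · have h := key (-Complex.I) (by rw [norm_neg, Complex.norm_I])
    rwa [neg_smul, _root_.map_neg, realPart_I_smul, neg_neg] at h
  · have h := key Complex.I Complex.norm_I
    rwa [realPart_I_smul, NegMemClass.coe_neg, CFC.posPart_neg] at h

variable (τ) in
/-- The trace, as a tracial functional on the operators of finite trace. -/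
noncomputable def traceFunctional : TracialFunctional N where
  cone := {P | P ∈ N ∧ 0 ≤ P ∧ τ.toFun P < ∞}
  val P := (τ.toFun P).toReal
  mem_alg _ h := h.1
  nonneg _ h := h.2.1
  zero_mem := ⟨zero_mem N, le_rfl, by simp [τ.map_zero]⟩
  add_mem P hP Q hQ := ⟨add_mem hP.1 hQ.1, add_nonneg hP.2.1 hQ.2.1, by
    rw [τ.map_add' P hP.1 Q hQ.1 hP.2.1 hQ.2.1]
    exact ENNReal.add_lt_top.2 ⟨hP.2.2, hQ.2.2⟩⟩
  posPart_mem P hP X hX hXs hXP := ⟨posPart_mem hX, CFC.posPart_nonneg X,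
    (τ.posPart_le hX hP.1 hXs hP.2.1 hXP).trans_lt hP.2.2⟩
  swap_mem X hX h := ⟨mul_mem hX (star_mem hX), mul_star_self_nonneg X, by
    rw [← τ.tracial' X hX]
    exact h.2.2⟩
  val_add P hP Q hQ := by
    rw [τ.map_add' P hP.1 Q hQ.1 hP.2.1 hQ.2.1, ENNReal.toReal_add hP.2.2.ne hQ.2.2.ne]
  val_swap X hX _ := by rw [τ.tracial' X hX]

theorem rpow_mem_traceFunctional_cone {P : H →L[ℂ] H} (hP : P ∈ τ.logCone) {s : ℝ} (hs : 0 < s) :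
    P ^ (1 + s) ∈ τ.traceFunctional.cone :=
  ⟨rpow_mem hP.1 _, CFC.rpow_nonneg, trace_rpow_lt_top hP hs⟩

theorem sqrt_mul_rpow_mul_sqrt {P : H →L[ℂ] H} {s : ℝ} (hs : 0 < s) :
    CFC.sqrt P * P ^ s * CFC.sqrt P = P ^ (1 + s) := by
  rw [CFC.sqrt_eq_rpow, CFC.rpow_mul_rpow (by norm_num) hs,
    CFC.rpow_mul_rpow (by positivity) (by norm_num)]
  congr 1
  ring

theorem sqrt_rpow_mul_mul_sqrt_rpow {P : H →L[ℂ] H} (hP : 0 ≤ P) {s : ℝ} (hs : 0 < s) :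
    CFC.sqrt (P ^ s) * P * CFC.sqrt (P ^ s) = P ^ (1 + s) := by
  rw [CFC.sqrt_rpow' hs.le]
  nth_rw 2 [← CFC.rpow_one P]
  rw [CFC.rpow_mul_rpow (by positivity) one_pos, CFC.rpow_mul_rpow (by positivity) (by positivity)]
  congr 1
  ring

theorem conj_sqrt_nonneg (a : H →L[ℂ] H) {b : H →L[ℂ] H} (hb : 0 ≤ b) :
    0 ≤ CFC.sqrt a * b * CFC.sqrt a := by
  have h := star_left_conjugate_nonneg hb (CFC.sqrt a)
  rwa [(CFC.sqrt_nonneg a).isSelfAdjoint.star_eq] at h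

theorem conj_sqrt_le (a : H →L[ℂ] H) {b c : H →L[ℂ] H} (hbc : b ≤ c) :
    CFC.sqrt a * b * CFC.sqrt a ≤ CFC.sqrt a * c * CFC.sqrt a := by
  have h := star_left_conjugate_le_conjugate hbc (CFC.sqrt a)
  rwa [(CFC.sqrt_nonneg a).isSelfAdjoint.star_eq] at h

/-- `P^(1+s) = P^{1/2} P^s P^{1/2} ≤ P^{1/2} R^s P^{1/2}` by Löwner–Heinz, which needs `s ≤ 1`;
traciality then exchanges the roles. -/
theorem trace_rpow_le_of_le {P R : H →L[ℂ] H} (hP : P ∈ N) (hR : R ∈ N) (hP0 : 0 ≤ P)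
    (hPR : P ≤ R) {s : ℝ} (hs : 0 < s) (hs1 : s ≤ 1) :
    τ.toFun (P ^ (1 + s)) ≤ τ.toFun (CFC.sqrt (R ^ s) * P * CFC.sqrt (R ^ s)) := by
  rw [τ.sqrt_conj_comm (rpow_mem hR s) hP CFC.rpow_nonneg hP0, ← sqrt_mul_rpow_mul_sqrt hs]
  refine τ.mono (mul_mem (mul_mem (sqrt_mem hP) (rpow_mem hP s)) (sqrt_mem hP))
    (mul_mem (mul_mem (sqrt_mem hP) (rpow_mem hR s)) (sqrt_mem hP))
    (conj_sqrt_nonneg _ CFC.rpow_nonneg) (conj_sqrt_le _ ?_)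
  exact CFC.rpow_le_rpow ⟨hs.le, hs1⟩ hPR

theorem trace_rpow_add_le {P Q : H →L[ℂ] H} (hP : P ∈ N) (hQ : Q ∈ N) (hP0 : 0 ≤ P)
    (hQ0 : 0 ≤ Q) {s : ℝ} (hs : 0 < s) (hs1 : s ≤ 1) :
    τ.toFun (P ^ (1 + s)) + τ.toFun (Q ^ (1 + s)) ≤ τ.toFun ((P + Q) ^ (1 + s)) := by
  have hR := add_mem hP hQ
  have hsN := sqrt_mem (rpow_mem hR s)
  refine (add_le_add
    (trace_rpow_le_of_le hP hR hP0 (le_add_of_nonneg_right hQ0) hs hs1)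
    (trace_rpow_le_of_le hQ hR hQ0 (le_add_of_nonneg_left hP0) hs hs1)).trans_eq ?_
  rw [← τ.map_add' _ (mul_mem (mul_mem hsN hP) hsN) _ (mul_mem (mul_mem hsN hQ) hsN)
    (conj_sqrt_nonneg _ hP0) (conj_sqrt_nonneg _ hQ0), ← add_mul, ← mul_add,
    sqrt_rpow_mul_mul_sqrt_rpow (add_nonneg hP0 hQ0) hs]

/-- Operator convexity of the power at the midpoint of `P` and `Q`; rescaling by `2^(1+s)` leaves
the factor `2^s`. -/
theorem trace_add_rpow_le {P Q : H →L[ℂ] H} (hP : P ∈ N) (hQ : Q ∈ N) (hP0 : 0 ≤ P)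
    (hQ0 : 0 ≤ Q) {s : ℝ} (hs : 0 < s) (hs1 : s < 1) :
    τ.toFun ((P + Q) ^ (1 + s)) ≤
      ENNReal.ofReal (2 ^ s) * (τ.toFun (P ^ (1 + s)) + τ.toFun (Q ^ (1 + s))) := by
  have hpN := rpow_mem hP (1 + s)
  have hqN := rpow_mem hQ (1 + s)
  have hcv := CFC.convexOn_rpow (A := H →L[ℂ] H) (p := 1 + s) ⟨by linarith, by linarith⟩
  have h := hcv.2 (Set.mem_Ici.2 hP0) (Set.mem_Ici.2 hQ0)
    (show (0 : ℝ) ≤ 1 / 2 by norm_num) (show (0 : ℝ) ≤ 1 / 2 by norm_num) (by norm_num)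
  simp only [← smul_add] at h
  rw [CFC.smul_rpow (add_nonneg hP0 hQ0) (by norm_num) (by positivity)] at h
  have h2 : (P + Q) ^ (1 + s) ≤ (2 ^ s : ℝ) • (P ^ (1 + s) + Q ^ (1 + s)) := by
    have h3 := smul_le_smul_of_nonneg_left h (a := (2 : ℝ) ^ (1 + s)) (by positivity)
    rw [smul_smul, smul_smul, ← Real.mul_rpow (by norm_num) (by norm_num)] at h3
    have e : (2 : ℝ) ^ (1 + s) * (1 / 2) = 2 ^ s := by
      rw [Real.rpow_add (by norm_num), Real.rpow_one]; ring
    rw [e] at h3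
    norm_num at h3
    rwa [smul_add]
  refine (τ.mono (rpow_mem (add_mem hP hQ) _) (real_smul_mem _ (add_mem hpN hqN))
    CFC.rpow_nonneg h2).trans_eq ?_
  rw [τ.map_smul' _ (by positivity) _ (add_mem hpN hqN)
    (add_nonneg CFC.rpow_nonneg CFC.rpow_nonneg), τ.map_add' _ hpN _ hqN CFC.rpow_nonneg
    CFC.rpow_nonneg]

variable (τ) in
/-- The function `t ↦ t⁻¹ τ(Q^{1/2} b Q^{1/2})`, `Q = P ^ (1 + 1/t)`, for positive `P` and `b`. -/
noncomputable def zetaFunConj (b P : H →L[ℂ] H) (t : Set.Ioi (0 : ℝ)) : ℝ :=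
  1 / (t : ℝ) * (τ.toFun (CFC.sqrt (P ^ (1 + 1 / (t : ℝ))) * b *
    CFC.sqrt (P ^ (1 + 1 / (t : ℝ))))).toReal

theorem zetaFunConj_one (P : H →L[ℂ] H) : τ.zetaFunConj 1 P = τ.zetaFun P := by
  ext t
  rw [zetaFunConj, zetaFun, mul_one, CFC.sqrt_mul_sqrt_self _ CFC.rpow_nonneg]

theorem conj_mem_traceFunctional_cone {P b : H →L[ℂ] H} (hP : P ∈ τ.logCone) (hb : b ∈ N)
    (hb0 : 0 ≤ b) {s : ℝ} (hs : 0 < s) :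
    CFC.sqrt (P ^ (1 + s)) * b * CFC.sqrt (P ^ (1 + s)) ∈ τ.traceFunctional.cone :=
  TracialFunctional.sqrt_conj_mem (rpow_mem_traceFunctional_cone hP hs) hb hb0

theorem zetaFunConj_add {P b c : H →L[ℂ] H} (hP : P ∈ τ.logCone) (hb : b ∈ N) (hb0 : 0 ≤ b)
    (hc : c ∈ N) (hc0 : 0 ≤ c) (t : Set.Ioi (0 : ℝ)) :
    τ.zetaFunConj (b + c) P t = τ.zetaFunConj b P t + τ.zetaFunConj c P t := by
  have ht : 0 < 1 / (t : ℝ) := one_div_pos.2 t.2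
  have h := τ.traceFunctional.val_add _ (conj_mem_traceFunctional_cone hP hb hb0 ht) _
    (conj_mem_traceFunctional_cone hP hc hc0 ht)
  rw [← add_mul, ← mul_add] at h
  change (τ.toFun _).toReal = (τ.toFun _).toReal + (τ.toFun _).toReal at h
  rw [zetaFunConj, h, zetaFunConj, zetaFunConj]
  ring

theorem zetaFunConj_natCast {P : H →L[ℂ] H} (hP : P ∈ τ.logCone) (n : ℕ)
    (t : Set.Ioi (0 : ℝ)) : τ.zetaFunConj (n : H →L[ℂ] H) P t = n * τ.zetaFun P t := by
  rw [← zetaFunConj_one]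
  induction n with
  | zero => simp [zetaFunConj, τ.map_zero]
  | succ n ih =>
    rw [Nat.cast_succ, zetaFunConj_add hP (natCast_mem N n)
      (by rw [← nsmul_one]; exact nsmul_nonneg zero_le_one n) (one_mem N) zero_le_one, ih]
    push_cast
    ring

theorem zetaFunConj_nonneg (b P : H →L[ℂ] H) (t : Set.Ioi (0 : ℝ)) : 0 ≤ τ.zetaFunConj b P t :=
  mul_nonneg (one_div_nonneg.2 (le_of_lt t.2)) ENNReal.toReal_nonneg

theorem le_natCast_of_norm_le {b : H →L[ℂ] H} (hb : 0 ≤ b) {n : ℕ} (hn : ‖b‖ ≤ n) :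
    b ≤ (n : H →L[ℂ] H) := by
  have h := hb.isSelfAdjoint.le_algebraMap_norm_self.trans
    (algebraMap_mono (H →L[ℂ] H) hn)
  rwa [_root_.map_natCast] at h

theorem zetaFun_le {P : H →L[ℂ] H} (hP : P ∈ τ.logCone) :
    ∃ K : ℝ, ∀ t : Set.Ioi (0 : ℝ), (1 : ℝ) ≤ t → τ.zetaFun P t ≤ K := by
  obtain ⟨K, hK0, hK⟩ := exists_trace_rpow_le hP
  refine ⟨K, fun t ht => ?_⟩
  have ht0 : 0 < (t : ℝ) := t.2
  have h := ENNReal.toReal_mono ENNReal.ofReal_ne_top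
    (hK (1 / (t : ℝ)) (by positivity) (by rw [div_le_one ht0]; exact ht))
  rw [ENNReal.toReal_ofReal (by positivity)] at h
  calc τ.zetaFun P t ≤ 1 / (t : ℝ) * (K / (1 / (t : ℝ))) :=
        mul_le_mul_of_nonneg_left h (by positivity)
    _ = K := by field_simp

theorem rpow_antitone_of_le_one {Q : H →L[ℂ] H} (hQ0 : 0 ≤ Q) (hQ1 : Q ≤ 1) {p q : ℝ}
    (hp : 0 < p) (hpq : p ≤ q) : Q ^ q ≤ Q ^ p := by
  rw [CFC.rpow_eq_cfc_real hQ0, CFC.rpow_eq_cfc_real hQ0]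
  refine cfc_mono (fun x hx => ?_) (Real.continuous_rpow_const (by linarith)).continuousOn
    (Real.continuous_rpow_const hp.le).continuousOn
  have hx0 : 0 ≤ x := spectrum_nonneg_of_nonneg hQ0 hx
  have hx1 : x ≤ 1 := by
    have := (le_algebraMap_iff_spectrum_le (a := Q) (r := (1 : ℝ))).1 (by simpa using hQ1) x hx
    exact this
  rcases hx0.eq_or_lt with rfl | h
  · rw [Real.zero_rpow (by linarith), Real.zero_rpow hp.ne']
  · exact Real.rpow_le_rpow_of_exponent_ge h hx1 hpq

/-- After rescaling `P` to a contraction `Q`, the powers `Q^(1+1/t)` increase with `t`. The trace is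
then monotone in `t`, hence measurable. -/
theorem measurable_zetaFunConj {P b : H →L[ℂ] H} (hP : P ∈ N) (hP0 : 0 ≤ P) (hb : b ∈ N)
    (hb0 : 0 ≤ b) : Measurable (τ.zetaFunConj b P) := by
  set c : ℝ := ‖P‖ + 1 with hc
  have hc0 : 0 < c := by positivity
  set Q : H →L[ℂ] H := c⁻¹ • P with hQ
  have hQN : Q ∈ N := real_smul_mem _ hP
  have hQ0 : 0 ≤ Q := smul_nonneg (by positivity) hP0
  have hQ1 : Q ≤ 1 := by
    have h1 := hP0.isSelfAdjoint.le_algebraMap_norm_self.trans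
      (algebraMap_mono (H →L[ℂ] H) (show ‖P‖ ≤ c by rw [hc]; linarith))
    have h2 := smul_le_smul_of_nonneg_left h1 (a := c⁻¹) (by positivity)
    rwa [Algebra.algebraMap_eq_smul_one, smul_smul, inv_mul_cancel₀ hc0.ne', one_smul] at h2
  have e : P = c • Q := by rw [hQ, smul_smul, mul_inv_cancel₀ hc0.ne', one_smul]
  have hsb := sqrt_mem hb
  set f : Set.Ioi (0 : ℝ) → ℝ≥0∞ := fun t =>
    τ.toFun (CFC.sqrt b * Q ^ (1 + 1 / (t : ℝ)) * CFC.sqrt b) with hf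
  have hmono : Monotone f := by
    intro t u htu
    have ht : 0 < (t : ℝ) := t.2
    have htu' : (t : ℝ) ≤ u := htu
    refine τ.mono (mul_mem (mul_mem hsb (rpow_mem hQN _)) hsb)
      (mul_mem (mul_mem hsb (rpow_mem hQN _)) hsb) (conj_sqrt_nonneg _ CFC.rpow_nonneg)
      (conj_sqrt_le _ (rpow_antitone_of_le_one hQ0 hQ1 ?_ ?_))
    · have : 0 < (u : ℝ) := u.2
      positivity
    · gcongr
  have hfm : Measurable f := hmono.measurable
  have e2 : τ.zetaFunConj b P =
      fun t : Set.Ioi (0 : ℝ) => 1 / (t : ℝ) * (c ^ (1 + 1 / (t : ℝ)) * (f t).toReal) := by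
    ext t
    have ht : 0 < (t : ℝ) := t.2
    rw [zetaFunConj, τ.sqrt_conj_comm (rpow_mem hP _) hb CFC.rpow_nonneg hb0, e,
      CFC.smul_rpow hQ0 hc0.le (by positivity), mul_smul_comm, smul_mul_assoc,
      τ.map_smul' _ (by positivity) _ (mul_mem (mul_mem hsb (rpow_mem hQN _)) hsb)
      (conj_sqrt_nonneg _ CFC.rpow_nonneg), ENNReal.toReal_mul,
      ENNReal.toReal_ofReal (by positivity)]
  rw [e2]
  have := hfm.ennreal_toReal
  fun_prop

theorem tailPart_zetaFunConj_mem {P b : H →L[ℂ] H} (hP : P ∈ τ.logCone) (hb : b ∈ N)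
    (hb0 : 0 ≤ b) : tailPart (τ.zetaFunConj b P) ∈ LInfty := by
  have hset : MeasurableSet {t : Set.Ioi (0 : ℝ) | (1 : ℝ) ≤ t} :=
    measurableSet_le measurable_const measurable_subtype_coe
  refine ⟨((measurable_zetaFunConj hP.1 hP.2.1 hb hb0).indicator hset).aemeasurable, ?_⟩
  obtain ⟨K, hK⟩ := zetaFun_le hP
  obtain ⟨n, hn⟩ := exists_nat_ge ‖b‖
  refine ⟨n * max K 0, fun t => ?_⟩
  by_cases ht : (1 : ℝ) ≤ t
  · rw [tailPart, Set.indicator_of_mem (by exact ht), abs_of_nonneg (zetaFunConj_nonneg b P t)]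
    -- Adding the nonnegative contribution of `n - b` bounds the function by `n` times the zeta
    -- function of `P`.
    have h := zetaFunConj_add hP hb hb0 (sub_mem (natCast_mem N n) hb)
      (sub_nonneg.2 (le_natCast_of_norm_le hb0 hn)) t
    rw [add_sub_cancel, zetaFunConj_natCast hP] at h
    have h1 := zetaFunConj_nonneg (τ := τ) ((n : H →L[ℂ] H) - b) P t
    have h2 := mul_le_mul_of_nonneg_left ((hK t ht).trans (le_max_left K 0))
      (Nat.cast_nonneg (α := ℝ) n)
    linarith
  · rw [tailPart, Set.indicator_of_notMem (by exact ht), abs_zero]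
    positivity

theorem tailPart_zetaFun_mem {P : H →L[ℂ] H} (hP : P ∈ τ.logCone) :
    tailPart (τ.zetaFun P) ∈ LInfty := by
  rw [← zetaFunConj_one]
  exact tailPart_zetaFunConj_mem hP (one_mem N) zero_le_one

theorem eval_zetaFun_add (γ : GeneralisedLimit) {P Q : H →L[ℂ] H} (hP : P ∈ τ.logCone)
    (hQ : Q ∈ τ.logCone) :
    γ.eval (τ.zetaFun (P + Q)) = γ.eval (τ.zetaFun P) + γ.eval (τ.zetaFun Q) := by
  have mP := tailPart_zetaFun_mem hP
  have mQ := tailPart_zetaFun_mem hQ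
  have hPQ := add_mem_logCone hP hQ
  have mPQ := tailPart_zetaFun_mem hPQ
  rw [← γ.eval_add mP mQ]
  refine le_antisymm
    (γ.eval_le_of_le_rpow_mul mPQ (tailPart_add_mem mP mQ) two_pos fun t ht => ?_)
    (γ.eval_mono (tailPart_add_mem mP mQ) mPQ fun t ht => ?_)
  all_goals
    have ht0 : 0 < (t : ℝ) := t.2
    have hs : 0 < 1 / (t : ℝ) := by positivity
    have fP := (trace_rpow_lt_top hP hs).ne
    have fQ := (trace_rpow_lt_top hQ hs).ne
    unfold zetaFun
  · have h := ENNReal.toReal_mono (ENNReal.mul_ne_top ENNReal.ofReal_ne_top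
      (ENNReal.add_ne_top.2 ⟨fP, fQ⟩)) (τ.trace_add_rpow_le hP.1 hQ.1 hP.2.1 hQ.2.1 hs
        (by rw [div_lt_one ht0]; exact ht))
    rw [ENNReal.toReal_mul, ENNReal.toReal_ofReal (by positivity), ENNReal.toReal_add fP fQ] at h
    rw [← mul_add, mul_left_comm]
    exact mul_le_mul_of_nonneg_left h hs.le
  · have h := ENNReal.toReal_mono (trace_rpow_lt_top hPQ hs).ne
      (τ.trace_rpow_add_le hP.1 hQ.1 hP.2.1 hQ.2.1 hs (by rw [div_le_one ht0]; exact ht))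
    rw [ENNReal.toReal_add fP fQ] at h
    rw [← mul_add]
    exact mul_le_mul_of_nonneg_left h hs.le

variable (τ) in
/-- The zeta functional, as a tracial functional on the cone `logCone`. -/
noncomputable def zetaFunctional (γ : GeneralisedLimit) : TracialFunctional N where
  cone := τ.logCone
  val P := γ.eval (τ.zetaFun P)
  mem_alg _ h := h.1
  nonneg _ h := h.2.1
  zero_mem := zero_mem_logCone
  add_mem _ hP _ hQ := add_mem_logCone hP hQ
  posPart_mem _ hP _ hX hXs hXP := posPart_mem_logCone hP hX hXs hXP
  swap_mem _ hX h := swap_mem_logCone hX h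
  val_add _ hP _ hQ := eval_zetaFun_add γ hP hQ
  val_swap X hX _ := by
    congr 1
    ext t
    rw [zetaFun, zetaFun, τ.rpow_swap hX (one_div_pos.2 t.2)]

/-- With `X = P^{1/2} b P^{1/2} ≤ nP`, comparison with `nP` gives `n^s` times the trace of `P^{s/2}
X P^{s/2}`, which is the conjugate of `b` by `P^((1+s)/2)`. -/
theorem zetaFun_conj_le {P b : H →L[ℂ] H} (hP : P ∈ τ.logCone) (hb : b ∈ N) (hb0 : 0 ≤ b)
    {n : ℕ} (hbn : b ≤ n) (t : Set.Ioi (0 : ℝ)) (ht : (1 : ℝ) ≤ t) :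
    τ.zetaFun (CFC.sqrt P * b * CFC.sqrt P) t ≤ (n : ℝ) ^ (1 / (t : ℝ)) * τ.zetaFunConj b P t := by
  have ht0 : 0 < (t : ℝ) := t.2
  set s : ℝ := 1 / (t : ℝ) with hs
  have hs0 : 0 < s := by positivity
  have hs1 : s ≤ 1 := by rw [hs, div_le_one ht0]; exact ht
  set X := CFC.sqrt P * b * CFC.sqrt P with hX
  have hsP := sqrt_mem hP.1
  have hXN : X ∈ N := mul_mem (mul_mem hsP hb) hsP
  have hX0 : 0 ≤ X := conj_sqrt_nonneg P hb0
  have hXP : X ≤ (n : ℝ) • P := by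
    refine (conj_sqrt_le P hbn).trans_eq ?_
    rw [← nsmul_one, mul_smul_comm, mul_one, smul_mul_assoc,
      CFC.sqrt_mul_sqrt_self P hP.2.1, Nat.cast_smul_eq_nsmul]
  have hconj : CFC.sqrt (P ^ s) * X * CFC.sqrt (P ^ s) =
      CFC.sqrt (P ^ (1 + s)) * b * CFC.sqrt (P ^ (1 + s)) := by
    have e1 : CFC.sqrt (P ^ s) * CFC.sqrt P = CFC.sqrt (P ^ (1 + s)) := by
      rw [CFC.sqrt_rpow' hs0.le, CFC.sqrt_rpow' (by positivity), CFC.sqrt_eq_rpow,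
        CFC.rpow_mul_rpow (by positivity) (by norm_num)]
      congr 1
      ring
    have e2 : CFC.sqrt P * CFC.sqrt (P ^ s) = CFC.sqrt (P ^ (1 + s)) := by
      rw [CFC.sqrt_rpow' hs0.le, CFC.sqrt_rpow' (by positivity), CFC.sqrt_eq_rpow,
        CFC.rpow_mul_rpow (by norm_num) (by positivity)]
      congr 1
      ring
    calc CFC.sqrt (P ^ s) * X * CFC.sqrt (P ^ s)
        = (CFC.sqrt (P ^ s) * CFC.sqrt P) * b * (CFC.sqrt P * CFC.sqrt (P ^ s)) := by
          rw [hX]; noncomm_ring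
      _ = _ := by rw [e1, e2]
  have hcm := conj_mem_traceFunctional_cone hP hb hb0 hs0
  have h : τ.toFun (X ^ (1 + s)) ≤ ENNReal.ofReal ((n : ℝ) ^ s) *
      τ.toFun (CFC.sqrt (P ^ (1 + s)) * b * CFC.sqrt (P ^ (1 + s))) := by
    refine (trace_rpow_le_of_le hXN (real_smul_mem _ hP.1) hX0 hXP hs0 hs1).trans_eq ?_
    rw [← hconj, τ.sqrt_conj_comm (rpow_mem (real_smul_mem _ hP.1) s) hXN CFC.rpow_nonneg hX0,
      τ.sqrt_conj_comm (rpow_mem hP.1 s) hXN CFC.rpow_nonneg hX0,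
      CFC.smul_rpow hP.2.1 (Nat.cast_nonneg n) hs0.le, mul_smul_comm, smul_mul_assoc,
      τ.map_smul' _ (by positivity) _
        (mul_mem (mul_mem (sqrt_mem hXN) (rpow_mem hP.1 s)) (sqrt_mem hXN))
        (conj_sqrt_nonneg _ CFC.rpow_nonneg)]
  have h2 := ENNReal.toReal_mono (ENNReal.mul_ne_top ENNReal.ofReal_ne_top hcm.2.2.ne) h
  rw [ENNReal.toReal_mul, ENNReal.toReal_ofReal (by positivity)] at h2
  rw [zetaFun, zetaFunConj, ← hs, mul_left_comm]
  exact mul_le_mul_of_nonneg_left h2 hs0.le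

/-- Only one inequality is available directly. Used for both `b` and `n - b`, it must be an
equality, because on each side the two values add up to `n` times the value of the zeta functional
at `P`. -/
theorem eval_zetaFunConj (γ : GeneralisedLimit) {P b : H →L[ℂ] H} (hP : P ∈ τ.logCone)
    (hb : b ∈ N) (hb0 : 0 ≤ b) :
    γ.eval (τ.zetaFunConj b P) = γ.eval (τ.zetaFun (CFC.sqrt P * b * CFC.sqrt P)) := by
  obtain ⟨m, hm⟩ := exists_nat_ge ‖b‖
  set n : ℕ := m + 1 with hn
  have hn0 : (0 : ℝ) < n := by rw [hn]; positivity
  have hbn : b ≤ n := le_natCast_of_norm_le hb0 (hm.trans (by rw [hn]; push_cast; linarith))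
  have hnN : (n : H →L[ℂ] H) ∈ N := natCast_mem N n
  have hle {c : H →L[ℂ] H} (hc : c ∈ N) (hc0 : 0 ≤ c) (hcn : c ≤ n) :
      γ.eval (τ.zetaFun (CFC.sqrt P * c * CFC.sqrt P)) ≤ γ.eval (τ.zetaFunConj c P) :=
    γ.eval_le_of_le_rpow_mul
      (tailPart_zetaFun_mem ((τ.zetaFunctional γ).sqrt_conj_mem hP hc hc0))
      (tailPart_zetaFunConj_mem hP hc hc0) hn0 fun t ht => zetaFun_conj_le hP hc hc0 hcn t ht.le
  have hc : (n : H →L[ℂ] H) - b ∈ N := sub_mem hnN hb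
  have hc0 : 0 ≤ (n : H →L[ℂ] H) - b := sub_nonneg.2 hbn
  have h₁ := hle hb hb0 hbn
  have h₂ := hle hc hc0 (sub_le_self _ hb0)
  have h₃ := γ.eval_add (tailPart_zetaFunConj_mem hP hb hb0) (tailPart_zetaFunConj_mem hP hc hc0)
  simp only [← zetaFunConj_add hP hb hb0 hc hc0, add_sub_cancel, zetaFunConj_natCast hP] at h₃
  rw [γ.eval_const_mul _ (tailPart_zetaFun_mem hP)] at h₃
  have h₄ := (τ.zetaFunctional γ).val_add _ (TracialFunctional.sqrt_conj_mem hP hb hb0) _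
    (TracialFunctional.sqrt_conj_mem hP hc hc0)
  have h₅ := TracialFunctional.val_nsmul (φ := τ.zetaFunctional γ) hP n
  rw [← add_mul, ← mul_add, add_sub_cancel, ← nsmul_one, mul_smul_comm, mul_one, smul_mul_assoc,
      CFC.sqrt_mul_sqrt_self P hP.2.1, h₅] at h₄
  change _ * γ.eval _ = γ.eval _ + γ.eval _ at h₄
  rw [nsmul_one] at h₄
  linarith

end FNSTrace

end Zeta

/-! ### Arbitrary `A` and `B`: expanding both functionals by linearity. -/

section ZetaTwisted

variable {H : Type*} [NormedAddCommGroup H] [InnerProductSpace ℂ H] [CompleteSpace H]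

theorem JordanForall.mono {p q : (H →L[ℂ] H) → Prop} {A : H →L[ℂ] H} (h : JordanForall p A)
    (hpq : ∀ P, p P → q P) : JordanForall q A :=
  ⟨hpq _ h.1, hpq _ h.2.1, hpq _ h.2.2.1, hpq _ h.2.2.2⟩

theorem JordanForall.jordanExtend_congr {p : (H →L[ℂ] H) → Prop} {A : H →L[ℂ] H}
    (h : JordanForall p A) {F G : (H →L[ℂ] H) → ℂ} (hFG : ∀ P, p P → F P = G P) :
    jordanExtend F A = jordanExtend G A := by
  unfold jordanExtend
  rw [hFG _ h.1, hFG _ h.2.1, hFG _ h.2.2.1, hFG _ h.2.2.2]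

namespace FNSTrace

variable {N : VonNeumannAlgebra H} {τ : FNSTrace N}

open VonNeumannAlgebra

theorem jordanForall_mem_nonneg {B : H →L[ℂ] H} (hB : B ∈ N) :
    JordanForall (fun b => b ∈ N ∧ 0 ≤ b) B :=
  ⟨⟨posPart_mem (realPart_mem hB), CFC.posPart_nonneg _⟩,
    ⟨negPart_mem (realPart_mem hB), CFC.negPart_nonneg _⟩,
    ⟨posPart_mem (imaginaryPart_mem hB), CFC.posPart_nonneg _⟩,
    ⟨negPart_mem (imaginaryPart_mem hB), CFC.negPart_nonneg _⟩⟩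

theorem finite_rpow_mul {P B : H →L[ℂ] H} (hP : P ∈ τ.logCone) (hB : B ∈ N) {s : ℝ}
    (hs : 0 < s) : τ.Finite (P ^ (1 + s) * B) :=
  (TracialFunctional.mul_mem_domain_of_mem_cone (rpow_mem_traceFunctional_cone hP hs) hB).1.2.mono
    fun _ h => h.2.2

/-- The product formula for the trace functional at `P^(1+1/t)` reduces the twisted trace to
positive conjugates, which are real; this separates the real and imaginary parts. -/
theorem zetaFunTwisted_eq {P B : H →L[ℂ] H} (hP : P ∈ τ.logCone) (hB : B ∈ N)
    (t : Set.Ioi (0 : ℝ)) :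
    τ.zetaFunTwisted B P t =
      ((τ.zetaFunConj (ℜ B : H →L[ℂ] H)⁺ P t - τ.zetaFunConj (ℜ B : H →L[ℂ] H)⁻ P t : ℝ) : ℂ) +
      Complex.I *
        ((τ.zetaFunConj (ℑ B : H →L[ℂ] H)⁺ P t - τ.zetaFunConj (ℑ B : H →L[ℂ] H)⁻ P t : ℝ) : ℂ) := by
  have h : τ.ext (P ^ (1 + 1 / (t : ℝ)) * B) = jordanExtend (fun b =>
      ((τ.toFun (CFC.sqrt (P ^ (1 + 1 / (t : ℝ))) * b *
        CFC.sqrt (P ^ (1 + 1 / (t : ℝ))))).toReal : ℂ)) B :=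
    (TracialFunctional.mul_mem_domain_of_mem_cone
      (rpow_mem_traceFunctional_cone hP (one_div_pos.2 t.2)) hB).2
  rw [zetaFunTwisted, h, jordanExtend]
  simp only [zetaFunConj]
  push_cast
  ring

theorem zetaFunTwisted_re {P B : H →L[ℂ] H} (hP : P ∈ τ.logCone) (hB : B ∈ N) :
    (fun t => (τ.zetaFunTwisted B P t).re) = fun t =>
      τ.zetaFunConj (ℜ B : H →L[ℂ] H)⁺ P t - τ.zetaFunConj (ℜ B : H →L[ℂ] H)⁻ P t := by
  ext t
  rw [zetaFunTwisted_eq hP hB, Complex.add_re, Complex.ofReal_re, Complex.re_mul_ofReal]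
  simp

theorem zetaFunTwisted_im {P B : H →L[ℂ] H} (hP : P ∈ τ.logCone) (hB : B ∈ N) :
    (fun t => (τ.zetaFunTwisted B P t).im) = fun t =>
      τ.zetaFunConj (ℑ B : H →L[ℂ] H)⁺ P t - τ.zetaFunConj (ℑ B : H →L[ℂ] H)⁻ P t := by
  ext t
  rw [zetaFunTwisted_eq hP hB, Complex.add_im, Complex.ofReal_im, Complex.im_mul_ofReal]
  simp

/-- The product formula for the zeta functional expands the right side over the Jordan parts of `B`;
the core identity matches each term. -/
theorem evalC_zetaFunTwisted (γ : GeneralisedLimit) {P B : H →L[ℂ] H} (hP : P ∈ τ.logCone)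
    (hB : B ∈ N) : γ.evalC (τ.zetaFunTwisted B P) = (τ.zetaFunctional γ).ext (P * B) := by
  obtain ⟨⟨m₁, p₁⟩, ⟨m₂, p₂⟩, ⟨m₃, p₃⟩, ⟨m₄, p₄⟩⟩ := jordanForall_mem_nonneg hB
  rw [(TracialFunctional.mul_mem_domain_of_mem_cone (φ := τ.zetaFunctional γ) hP hB).2,
    GeneralisedLimit.evalC, zetaFunTwisted_re hP hB, zetaFunTwisted_im hP hB,
    γ.eval_sub (tailPart_zetaFunConj_mem hP m₁ p₁) (tailPart_zetaFunConj_mem hP m₂ p₂),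
    γ.eval_sub (tailPart_zetaFunConj_mem hP m₃ p₃) (tailPart_zetaFunConj_mem hP m₄ p₄),
    eval_zetaFunConj γ hP m₁ p₁, eval_zetaFunConj γ hP m₂ p₂, eval_zetaFunConj γ hP m₃ p₃,
    eval_zetaFunConj γ hP m₄ p₄, Complex.ofReal_sub, Complex.ofReal_sub]
  rfl

theorem zetaTwistedDefined_of_mem_M1Infty {A B : H →L[ℂ] H} (hA : A ∈ τ.M1Infty) (hB : B ∈ N) :
    τ.ZetaTwistedDefined B A := by
  obtain ⟨⟨m₁, p₁⟩, ⟨m₂, p₂⟩, ⟨m₃, p₃⟩, ⟨m₄, p₄⟩⟩ := jordanForall_mem_nonneg hB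
  refine (jordanForall_mem_logCone hA).mono fun P hP =>
    ⟨fun t => finite_rpow_mul hP hB (one_div_pos.2 t.2), ?_, ?_⟩
  · rw [zetaFunTwisted_re hP hB]
    exact tailPart_sub_mem (tailPart_zetaFunConj_mem hP m₁ p₁) (tailPart_zetaFunConj_mem hP m₂ p₂)
  · rw [zetaFunTwisted_im hP hB]
    exact tailPart_sub_mem (tailPart_zetaFunConj_mem hP m₃ p₃) (tailPart_zetaFunConj_mem hP m₄ p₄)

theorem zetaDefined_of_mem_M1Infty {A : H →L[ℂ] H} (hA : A ∈ τ.M1Infty) : τ.ZetaDefined A :=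
  (jordanForall_mem_logCone hA).mono fun _ hP =>
    ⟨fun t => trace_rpow_lt_top hP (one_div_pos.2 t.2), tailPart_zetaFun_mem hP⟩

theorem zetaTwisted_eq_zeta_mul (γ : GeneralisedLimit) {A B : H →L[ℂ] H} (hA : A ∈ τ.M1Infty)
    (hB : B ∈ N) : τ.zetaTwisted γ B A = τ.zeta γ (A * B) := by
  have hAc := jordanForall_mem_logCone hA
  have h := (TracialFunctional.mul_mem_domain (φ := τ.zetaFunctional γ) ⟨hA.1, hAc⟩ hB).2
  exact (hAc.jordanExtend_congr fun P hP => evalC_zetaFunTwisted γ hP hB).trans h.symm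

end FNSTrace

end ZetaTwisted

theorem mainTheorem2 {H : Type*} [NormedAddCommGroup H] [InnerProductSpace ℂ H] [CompleteSpace H]
    (N : VonNeumannAlgebra H) (τ : FNSTrace N) (γ : GeneralisedLimit)
    (A B : H →L[ℂ] H) (hA : A ∈ τ.M1Infty) (hB : B ∈ N) :
    τ.ZetaTwistedDefined B A ∧ A * B ∈ τ.M1Infty ∧ τ.ZetaDefined (A * B) ∧
      τ.zetaTwisted γ B A = τ.zeta γ (A * B) := by
  have hAB : A * B ∈ τ.M1Infty := FNSTrace.mul_mem_M1Infty hA hB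
  exact ⟨FNSTrace.zetaTwistedDefined_of_mem_M1Infty hA hB, hAB,
    FNSTrace.zetaDefined_of_mem_M1Infty hAB, FNSTrace.zetaTwisted_eq_zeta_mul γ hA hB⟩
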